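/- Let $\Omega_1=(0,1)^2\subset\mathbb R^2$, with the Neumann condition on the side $\{1\}\times(0,1)$ and the Dirichlet condition on the other three sides. Let $\Omega_2=\{(x,y)\in\mathbb R^2: 0<x<\sqrt2,\ 0<y<x\}$, an isosceles right triangle with legs of length $\sqrt2$, with the Neumann condition on the leg $\{\sqrt2\}\times(0,\sqrt2)$ and the Dirichlet condition on the other leg $(0,\sqrt2)\times\{0\}$ and on the hypotenuse $\{(x,x):0<x<\sqrt2\}$. For $j=1,2$ let $\sigma_{DN}(\Omega_j)$ be the spectrum of the corresponding mixed Dirichlet–Neumann Laplacian $-\Delta$ on $L^2(\Omega_j)$, that is, of the self-adjoint operator of the form $\int_{\Omega_j}\nabla u\cdot\overline{\nabla v}$ on the space of $H^1(\Omega_j)$-functions vanishing on the Dirichlet part of the boundary. Then $$\sigma_{DN}(\Omega_1)=\sigma_{DN}(\Omega_2)$$ with account of multiplicities. More precisely, both spectra consist of eigenvalues of finite multiplicity, and, each eigenvalue being repeated according to its multiplicity, $\sigma_{DN}(\Omega_1)=\{\lambda_{m,n}\}_{m\ge0,\,n\ge1}$ and $\sigma_{DN}(\Omega_2)=\{\mu_{k,l}\}_{k>l\ge0}$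 ($m,n,k,l$ integers), where $$\lambda_{m,n}=\frac{\pi^2}{4}\bigl((2m+1)^2+4n^2\bigr),\qquad \mu_{k,l}=\frac{\pi^2}{8}\bigl((2k+1)^2+(2l+1)^2\bigr).$$ The two families are matched by a bijection between the index sets $\{(k,l):k>l\ge0\}$ and $\{(m,n): m\ge0,\ n\ge1\}$, given by $$\mu_{k,l}=\begin{cases}\lambda_{j,\,l+j+1}&\text{if }k-l=2j+1,\\ \lambda_{l+j,\,j}&\text{if }k-l=2j,\end{cases}$$ with inverse $$\lambda_{m,n}=\begin{cases}\mu_{m+n,\,m-n}&\text{if }m\ge n,\\ \mu_{m+n,\,n-m-1}&\text{if }m<n.\end{cases}$$ -/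

import Mathlib

open MeasureTheory
open scoped ContDiff

noncomputable section

/-! Conventions. The plane is `ℝ × ℝ` with Lebesgue measure; only its topology, its linear structure
and its measure are used, never its norm. Functions are complex valued. -/

/-- The Hilbert space `L²(Ω; ℂ)`. -/
abbrev L2 (Ω : Set (ℝ × ℝ)) : Type :=
  Lp ℂ 2 ((volume : Measure (ℝ × ℝ)).restrict Ω)

/-- `φ ∈ C_c^∞(ℝ²; ℂ)`, and `φ` vanishes in a neighbourhood of the closure of `D`. -/
structure IsTestFun (D : Set (ℝ × ℝ)) (φ : ℝ × ℝ → ℂ) : Prop where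
  contDiff : ContDiff ℝ ∞ φ
  hasCompactSupport : HasCompactSupport φ
  disjoint : Disjoint (tsupport φ) (closure D)

/-- `w = (φ, ∂φ/∂x, ∂φ/∂y)` almost everywhere in `Ω`. -/
def RepresentsJet (Ω : Set (ℝ × ℝ)) (φ : ℝ × ℝ → ℂ) (w : L2 Ω × L2 Ω × L2 Ω) : Prop :=
  (∀ᵐ p ∂((volume : Measure (ℝ × ℝ)).restrict Ω), w.1 p = φ p) ∧
  (∀ᵐ p ∂((volume : Measure (ℝ × ℝ)).restrict Ω), w.2.1 p = fderiv ℝ φ p (1, 0)) ∧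
  (∀ᵐ p ∂((volume : Measure (ℝ × ℝ)).restrict Ω), w.2.2 p = fderiv ℝ φ p (0, 1))

theorem IsTestFun.zero (D : Set (ℝ × ℝ)) : IsTestFun D (0 : ℝ × ℝ → ℂ) where
  contDiff := contDiff_const
  hasCompactSupport := HasCompactSupport.zero
  disjoint := by simp [tsupport]

theorem IsTestFun.add {D : Set (ℝ × ℝ)} {φ ψ : ℝ × ℝ → ℂ} (hφ : IsTestFun D φ)
    (hψ : IsTestFun D ψ) : IsTestFun D (φ + ψ) where
  contDiff := hφ.contDiff.add hψ.contDiff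
  hasCompactSupport := hφ.hasCompactSupport.add hψ.hasCompactSupport
  disjoint := (hφ.disjoint.union_left hψ.disjoint).mono_left (tsupport_add φ ψ)

theorem IsTestFun.smul {D : Set (ℝ × ℝ)} {φ : ℝ × ℝ → ℂ} (c : ℂ) (hφ : IsTestFun D φ) :
    IsTestFun D (c • φ) where
  contDiff := contDiff_const.smul hφ.contDiff
  hasCompactSupport := hφ.hasCompactSupport.smul_left (f := fun _ => c)
  disjoint := hφ.disjoint.mono_left
    (closure_mono (Function.support_const_smul_subset c φ))

/-- The jets `(φ, ∂φ/∂x, ∂φ/∂y)` on `Ω` of all smooth functions vanishing near `D`. -/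
def testJets (Ω D : Set (ℝ × ℝ)) : Submodule ℂ (L2 Ω × L2 Ω × L2 Ω) where
  carrier := {w | ∃ φ : ℝ × ℝ → ℂ, IsTestFun D φ ∧ RepresentsJet Ω φ w}
  zero_mem' := by
    refine ⟨0, IsTestFun.zero D, ?_, ?_, ?_⟩ <;>
    · filter_upwards [Lp.coeFn_zero ℂ 2 ((volume : Measure (ℝ × ℝ)).restrict Ω)] with p hp
      simpa using hp
  add_mem' := by
    rintro w w' ⟨φ, hφ, h0, h1, h2⟩ ⟨ψ, hψ, k0, k1, k2⟩
    have hd : ∀ p, fderiv ℝ (φ + ψ) p = fderiv ℝ φ p + fderiv ℝ ψ p := fun p =>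
      fderiv_add (hφ.contDiff.differentiable (by simp) p) (hψ.contDiff.differentiable (by simp) p)
    refine ⟨φ + ψ, hφ.add hψ, ?_, ?_, ?_⟩
    · filter_upwards [h0, k0, Lp.coeFn_add w.1 w'.1] with p a b c
      change (w.1 + w'.1 : L2 Ω) p = _
      rw [c, Pi.add_apply, a, b]
      rfl
    · filter_upwards [h1, k1, Lp.coeFn_add w.2.1 w'.2.1] with p a b c
      change (w.2.1 + w'.2.1 : L2 Ω) p = _
      rw [c, Pi.add_apply, a, b]
      simp [hd]
    · filter_upwards [h2, k2, Lp.coeFn_add w.2.2 w'.2.2] with p a b c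
      change (w.2.2 + w'.2.2 : L2 Ω) p = _
      rw [c, Pi.add_apply, a, b]
      simp [hd]
  smul_mem' := by
    rintro z w ⟨φ, hφ, h0, h1, h2⟩
    have hd : ∀ p, fderiv ℝ (z • φ) p = z • fderiv ℝ φ p := fun p =>
      fderiv_const_smul (hφ.contDiff.differentiable (by simp) p) z
    refine ⟨z • φ, hφ.smul z, ?_, ?_, ?_⟩
    · filter_upwards [h0, Lp.coeFn_smul z w.1] with p a c
      simp [c, a]
    · filter_upwards [h1, Lp.coeFn_smul z w.2.1] with p a c
      simp [c, a, hd]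
    · filter_upwards [h2, Lp.coeFn_smul z w.2.2] with p a c
      simp [c, a, hd]

/-- The form domain of the mixed problem: the Sobolev space `H¹_D(Ω)` of functions in `H¹(Ω)`
vanishing on `D`, i.e. the `H¹`-closure of the restrictions to `Ω` of smooth functions vanishing
near `D`. A function `u` is recorded with its weak gradient, as `(u, ∂u/∂x, ∂u/∂y)`; the product
topology of `L² × L² × L²` is then the topology of `H¹`. -/
def sobolevD (Ω D : Set (ℝ × ℝ)) : Submodule ℂ (L2 Ω × L2 Ω × L2 Ω) :=
  (testJets Ω D).topologicalClosure

/-- The graph of the operator `-Δ` on `L²(Ω)` with Dirichlet condition on `D` and Neumann condition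
on the rest of `∂Ω`, i.e. the operator of the Dirichlet form on `H¹_D(Ω)`: the pair `(u, f)` belongs
to it iff `u ∈ H¹_D(Ω)` and `∫_Ω ∇u · conj ∇v = ∫_Ω f conj v` for all `v ∈ H¹_D(Ω)` (the weak form
of `-Δu = f`, `u = 0` on `D`, `∂u/∂n = 0` on the rest of the boundary). -/
def mixedLaplacian (Ω D : Set (ℝ × ℝ)) : Submodule ℂ (L2 Ω × L2 Ω) where
  carrier := {q | ∃ g₁ g₂ : L2 Ω, (q.1, g₁, g₂) ∈ sobolevD Ω D ∧
    ∀ v d₁ d₂ : L2 Ω, (v, d₁, d₂) ∈ sobolevD Ω D →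
      inner ℂ d₁ g₁ + inner ℂ d₂ g₂ = inner ℂ v q.2}
  zero_mem' := ⟨0, 0, (sobolevD Ω D).zero_mem, fun v d₁ d₂ _ => by simp⟩
  add_mem' := by
    rintro q q' ⟨g₁, g₂, hm, h⟩ ⟨g₁', g₂', hm', h'⟩
    refine ⟨g₁ + g₁', g₂ + g₂', (sobolevD Ω D).add_mem hm hm', fun v d₁ d₂ hv => ?_⟩
    have e := h v d₁ d₂ hv
    have e' := h' v d₁ d₂ hv
    simp only [Prod.snd_add, inner_add_right]
    rw [← e, ← e']
    ring
  smul_mem' := by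
    rintro z q ⟨g₁, g₂, hm, h⟩
    refine ⟨z • g₁, z • g₂, (sobolevD Ω D).smul_mem z hm, fun v d₁ d₂ hv => ?_⟩
    have e := h v d₁ d₂ hv
    simp only [Prod.smul_snd, inner_smul_right]
    rw [← e]
    ring

/-- The spectrum `σ_DN(Ω)`: the `z ∈ ℂ` for which `-Δ - z` has no bounded everywhere defined
inverse `R` on `L²(Ω)`, where `R` is inverse to `-Δ - z` iff `(-Δ - z) u = f ↔ u = R f`. -/
def mixedSpectrum (Ω D : Set (ℝ × ℝ)) : Set ℂ :=
  {z | ¬ ∃ R : L2 Ω →L[ℂ] L2 Ω, ∀ u f : L2 Ω, (u, f + z • u) ∈ mixedLaplacian Ω D ↔ u = R f}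

/-- The space of solutions of `-Δu = z u` with the mixed boundary conditions. -/
def mixedEigenspace (Ω D : Set (ℝ × ℝ)) (z : ℂ) : Submodule ℂ (L2 Ω) :=
  (mixedLaplacian Ω D).comap (LinearMap.prod LinearMap.id (z • LinearMap.id))

/-- Equality of the two spectra, with multiplicities (dimensions of the eigenspaces). -/
def Isospectral (Ω₁ D₁ Ω₂ D₂ : Set (ℝ × ℝ)) : Prop :=
  mixedSpectrum Ω₁ D₁ = mixedSpectrum Ω₂ D₂ ∧
  ∀ z : ℂ, Module.rank ℂ (mixedEigenspace Ω₁ D₁ z) = Module.rank ℂ (mixedEigenspace Ω₂ D₂ z)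

/-- The mixed spectrum is purely discrete and is the family `(ev i)`, `i ∈ ι`, repeated according to
multiplicity: its points are the values `ev i`, and each `z` is an eigenvalue of finite multiplicity
equal to the number of indices `i` with `ev i = z` (zero if there are none). -/
def SpectrumIs {ι : Type} (Ω D : Set (ℝ × ℝ)) (ev : ι → ℝ) : Prop :=
  mixedSpectrum Ω D = Set.range (fun i => (ev i : ℂ)) ∧
  ∀ z : ℂ, FiniteDimensional ℂ (mixedEigenspace Ω D z) ∧
    (Module.finrank ℂ (mixedEigenspace Ω D z) : ℕ∞) = {i : ι | (ev i : ℂ) = z}.encard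

/-- The unit square. -/
def squareΩ : Set (ℝ × ℝ) := Set.Ioo 0 1 ×ˢ Set.Ioo 0 1

/-- The Dirichlet sides of the square: all but the side `{1} × (0,1)`, which is Neumann. -/
def squareD : Set (ℝ × ℝ) := {0} ×ˢ Set.Icc 0 1 ∪ Set.Ioo 0 1 ×ˢ {0, 1}

/-- The isosceles right triangle with legs of length `√2`. -/
def triangleΩ : Set (ℝ × ℝ) := {p | 0 < p.1 ∧ p.1 < √2 ∧ 0 < p.2 ∧ p.2 < p.1}

/-- The Dirichlet sides of the triangle: the leg `(0,√2) × {0}` and the hypotenuse; the other leg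
`{√2} × (0,√2)` is Neumann. -/
def triangleD : Set (ℝ × ℝ) := Set.Ioo 0 (√2) ×ˢ {0} ∪ {p | p.1 ∈ Set.Ioo 0 (√2) ∧ p.2 = p.1}

/-- The indices `(m, n)` with `m ≥ 0`, `n ≥ 1`. -/
abbrev SquareIndex : Type := {p : ℕ × ℕ // 1 ≤ p.2}

/-- The indices `(k, l)` with `k > l ≥ 0`. -/
abbrev TriangleIndex : Type := {p : ℕ × ℕ // p.2 < p.1}

/-- `λ_{m,n}` -/
def squareEV (p : SquareIndex) : ℝ :=
  Real.pi ^ 2 / 4 * ((2 * (p.1.1 : ℝ) + 1) ^ 2 + 4 * (p.1.2 : ℝ) ^ 2)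

/-- `μ_{k,l}` -/
def triangleEV (p : TriangleIndex) : ℝ :=
  Real.pi ^ 2 / 8 * ((2 * (p.1.1 : ℝ) + 1) ^ 2 + (2 * (p.1.2 : ℝ) + 1) ^ 2)

end

/-! Both problems have explicit complete orthogonal systems of eigenfunctions. On the square these
are products of sines. The triangle is half of a square of side `√2`, on which products of sines
with odd multiples of `π / (2√2)` satisfy the mixed conditions; antisymmetrising such a product
across the diagonal makes it vanish on the hypotenuse as well, and each pair `k > l` gives one mode.

Such a system settles the whole spectrum (`spectrumIs_of_orthogonal`): the graph of the operator is
symmetric and closed, so in the normalised basis it is diagonal, its eigenspaces are spanned by the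
modes, and its resolvent is given by bounded coefficients. No compact embedding and no regularity
theory is needed.

Two points are analytic. The modes vanish only on `D`, whereas the form domain is the closure of
functions vanishing near `D`; `jet_mem_sobolevD` bridges this by truncating small values, using that
the gradient is zero almost everywhere on the zero set. Completeness (`ae_eq_zero_of_orthogonal`) is
a Stone–Weierstrass argument: the span of the modes is stable under multiplication by two cosine
expressions which separate points, and contains a function without zeros.

The spectra agree because `(2k+1)² + (2l+1)² = 2((k+l+1)² + (k-l)²)`, where `k+l+1` and `k-l` have
opposite parity: the odd one is `2m+1` and the even one is `2n`. -/

/-! ### Symmetric closed relations with a basis of eigenvectors -/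

section SpectralExpansion

variable {H ι : Type*} [NormedAddCommGroup H] [InnerProductSpace ℂ H]

/-- The diagonal operator with bounded coefficients `d` in a Hilbert basis. -/
theorem HilbertBasis.exists_diagonal (b : HilbertBasis ι ℂ H)
    (d : ι → ℂ) (C : ℝ) (hC : ∀ i, ‖d i‖ ≤ C) :
    ∃ R : H →L[ℂ] H, ∀ f i, inner ℂ (b i) (R f) = d i * inner ℂ (b i) f := by
  let T : ∀ _ : ι, ℂ →L[ℂ] ℂ := fun i => d i • ContinuousLinearMap.id ℂ ℂ
  have hT : ∀ i, ‖T i‖ ≤ |C| := fun i => by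
    simpa [T, norm_smul] using (hC i).trans (le_abs_self C)
  refine ⟨b.repr.symm.toContinuousLinearEquiv.toContinuousLinearMap ∘L
    (lp.mapCLM 2 T (abs_nonneg C) hT) ∘L b.repr.toContinuousLinearEquiv.toContinuousLinearMap,
    fun f i => ?_⟩
  rw [← b.repr_apply_apply, ← b.repr_apply_apply]
  simp [lp.mapCLM, T]

/-- A linear relation which is symmetric. -/
def IsSymmRel (A : Submodule ℂ (H × H)) : Prop :=
  ∀ q ∈ A, ∀ r ∈ A, inner ℂ q.1 r.2 = inner ℂ q.2 r.1

variable {A : Submodule ℂ (H × H)} {b : HilbertBasis ι ℂ H} {ev : ι → ℝ}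

theorem IsSymmRel.inner_snd (hA : IsSymmRel A) (hb : ∀ i, (b i, (ev i : ℂ) • b i) ∈ A)
    {u f : H} (h : (u, f) ∈ A) (i : ι) :
    inner ℂ (b i) f = ev i * inner ℂ (b i) u := by
  have := hA _ (hb i) _ h
  simpa [inner_smul_left] using this

theorem IsSymmRel.inner_eq_zero (hA : IsSymmRel A) (hb : ∀ i, (b i, (ev i : ℂ) • b i) ∈ A)
    {u : H} {z : ℂ} (h : (u, z • u) ∈ A) {i : ι} (hi : (ev i : ℂ) ≠ z) :
    inner ℂ (b i) u = 0 := by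
  have := hA.inner_snd hb h i
  rw [inner_smul_right] at this
  have h2 : ((ev i : ℂ) - z) * inner ℂ (b i) u = 0 := by rw [sub_mul, this, sub_self]
  exact (mul_eq_zero.1 h2).resolve_left (sub_ne_zero.2 hi)

/-- By symmetry an eigenvector for `z` has no coefficient outside the level set `ev = z`. Since this
set is finite, the expansion is a finite sum and the algebraic span needs no closure. -/
theorem IsSymmRel.eigenspace_eq_span (hA : IsSymmRel A)
    (hb : ∀ i, (b i, (ev i : ℂ) • b i) ∈ A) {z : ℂ} (hz : {i | (ev i : ℂ) = z}.Finite) :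
    A.comap (LinearMap.prod LinearMap.id (z • LinearMap.id)) =
      Submodule.span ℂ (b '' {i | (ev i : ℂ) = z}) := by
  apply le_antisymm
  · intro u hu
    have h : (u, z • u) ∈ A := hu
    have hs := b.hasSum_repr u
    have hs' := hasSum_sum_of_ne_finset_zero (f := fun i => b.repr u i • b i)
      (L := .unconditional ι) (s := hz.toFinset) (fun i hi => by
        rw [b.repr_apply_apply, hA.inner_eq_zero hb h (by simpa using hi), zero_smul])
    rw [hs.unique hs']
    refine Submodule.sum_mem _ fun i hi => Submodule.smul_mem _ _ (Submodule.subset_span ?_)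
    exact ⟨i, by simpa using hi, rfl⟩
  · rw [Submodule.span_le]
    rintro _ ⟨i, hi, rfl⟩
    have : (ev i : ℂ) = z := hi
    change (b i, z • b i) ∈ A
    rw [← this]
    exact hb i

theorem IsSymmRel.finrank_eigenspace (hA : IsSymmRel A)
    (hb : ∀ i, (b i, (ev i : ℂ) • b i) ∈ A) {z : ℂ} (hz : {i | (ev i : ℂ) = z}.Finite) :
    FiniteDimensional ℂ (A.comap (LinearMap.prod LinearMap.id (z • LinearMap.id))) ∧
    (Module.finrank ℂ (A.comap (LinearMap.prod LinearMap.id (z • LinearMap.id))) : ℕ∞) =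
      {i | (ev i : ℂ) = z}.encard := by
  rw [hA.eigenspace_eq_span hb hz]
  have := hz.fintype
  refine ⟨FiniteDimensional.span_of_finite ℂ (hz.image b), ?_⟩
  have hli : LinearIndependent ℂ fun i : {i | (ev i : ℂ) = z} => b i :=
    b.orthonormal.linearIndependent.comp _ Subtype.val_injective
  have := finrank_span_eq_card hli
  have hr : Set.range (fun i : {i | (ev i : ℂ) = z} => b i) = b '' {i | (ev i : ℂ) = z} := by
    ext; simp
  rw [hr] at this
  rw [this, Set.encard, ENat.card_eq_coe_fintype_card]

/-- At an eigenvalue, a resolvent would send `0` to a basis vector. Elsewhere the candidate is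
diagonal with coefficients `(ev i - z)⁻¹`: symmetry shows that every solution is `R f`, and
closedness that `R f` is a solution. -/
theorem IsSymmRel.exists_resolvent_iff (hA : IsSymmRel A) (hc : IsClosed (A : Set (H × H)))
    (hb : ∀ i, (b i, (ev i : ℂ) • b i) ∈ A) (hfin : ∀ C : ℝ, {i | ev i ≤ C}.Finite) (z : ℂ) :
    (∃ R : H →L[ℂ] H, ∀ u f : H, (u, f + z • u) ∈ A ↔ u = R f) ↔
      z ∉ Set.range fun i => (ev i : ℂ) := by
  constructor
  · rintro ⟨R, hR⟩ ⟨i, rfl⟩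
    have h := (hR (b i) 0).1 (by simpa using hb i)
    rw [map_zero] at h
    exact b.orthonormal.ne_zero i h
  · intro hz
    have hne : ∀ i, (ev i : ℂ) - z ≠ 0 := fun i h => hz ⟨i, sub_eq_zero.1 h⟩
    -- All but finitely many `ev i` exceed `‖z‖ + 1`, and for those `‖ev i - z‖ ≥ 1`.
    obtain ⟨C, hC⟩ : ∃ C, ∀ i, ‖((ev i : ℂ) - z)⁻¹‖ ≤ C := by
      obtain ⟨C, hC⟩ := ((hfin (‖z‖ + 1)).image fun i => ‖((ev i : ℂ) - z)⁻¹‖).bddAbove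
      refine ⟨max C 1, fun i => ?_⟩
      by_cases hi : ev i ≤ ‖z‖ + 1
      · exact (hC ⟨i, hi, rfl⟩).trans (le_max_left _ _)
      · refine le_trans ?_ (le_max_right _ _)
        rw [norm_inv]
        apply inv_le_one_of_one_le₀
        have h1 := norm_sub_norm_le (ev i : ℂ) z
        have h2 : ev i ≤ ‖(ev i : ℂ)‖ := by simpa using le_abs_self (ev i)
        linarith
    obtain ⟨R, hR⟩ := b.exists_diagonal _ C hC
    refine ⟨R, fun u f => ⟨fun h => ?_, ?_⟩⟩
    · apply b.repr.injective
      ext i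
      rw [b.repr_apply_apply, b.repr_apply_apply, hR]
      have := hA.inner_snd hb h i
      rw [inner_add_right, inner_smul_right] at this
      rw [inv_mul_eq_div, eq_div_iff (hne i)]
      linear_combination -this
    · rintro rfl
      -- The partial sums lie in `A` and converge in both components.
      have h1 : HasSum (fun i => (b.repr (R f) i) • (b i, (ev i : ℂ) • b i))
          (R f, f + z • R f) := by
        refine HasSum.prodMk (b.hasSum_repr (R f)) ?_
        convert b.hasSum_repr (f + z • R f) using 2 with i
        change b.repr (R f) i • (ev i : ℂ) • b i = _
        rw [smul_smul]
        congr 1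
        rw [b.repr_apply_apply, b.repr_apply_apply, inner_add_right, inner_smul_right, hR]
        have := hne i
        field_simp
        ring
      exact hc.mem_of_tendsto h1 (Filter.Eventually.of_forall fun s =>
        A.sum_mem fun i _ => A.smul_mem _ (hb i))

end SpectralExpansion

/-! ### The mixed Laplacian is symmetric and closed -/

section MixedLaplacian

variable {Ω D : Set (ℝ × ℝ)}

theorem mixedLaplacian_symm : IsSymmRel (mixedLaplacian Ω D) := by
  rintro ⟨u, f⟩ ⟨g₁, g₂, hg, h⟩ ⟨v, k⟩ ⟨d₁, d₂, hd, h'⟩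
  have e1 := h _ _ _ hd
  have e2 := h' _ _ _ hg
  simp only at e1 e2 ⊢
  rw [← e2, ← inner_conj_symm f v, ← e1, map_add, inner_conj_symm, inner_conj_symm]

/-- Testing the difference of two equations with the difference of the solutions gives `‖∇(u_m -
u_n)‖² ≤ ‖u_m - u_n‖ ‖f_m - f_n‖`. Hence convergence in the graph makes the gradients Cauchy, and
both the form domain and the weak equation pass to the limit. -/
theorem isClosed_mixedLaplacian : IsClosed (mixedLaplacian Ω D : Set (L2 Ω × L2 Ω)) := by
  rw [← isSeqClosed_iff_isClosed]
  intro q q₀ hq hlim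
  choose g₁ g₂ hg h using hq
  have hmem : ∀ m n, (((q m).1 - (q n).1, g₁ m - g₁ n, g₂ m - g₂ n) : L2 Ω × L2 Ω × L2 Ω) ∈
      sobolevD Ω D := fun m n => (sobolevD Ω D).sub_mem (hg m) (hg n)
  have key : ∀ m n, ‖g₁ m - g₁ n‖ ^ 2 + ‖g₂ m - g₂ n‖ ^ 2 ≤
      ‖(q m).1 - (q n).1‖ * ‖(q m).2 - (q n).2‖ := fun m n => by
    have e1 := h m _ _ _ (hmem m n)
    have e2 := h n _ _ _ (hmem m n)
    have e3 : inner ℂ (g₁ m - g₁ n) (g₁ m - g₁ n) + inner ℂ (g₂ m - g₂ n) (g₂ m - g₂ n) =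
        inner ℂ ((q m).1 - (q n).1) ((q m).2 - (q n).2) := by
      rw [inner_sub_right _ (g₁ m), inner_sub_right _ (g₂ m), inner_sub_right _ (q m).2,
        ← e1, ← e2]
      ring
    rw [inner_self_eq_norm_sq_to_K, inner_self_eq_norm_sq_to_K] at e3
    have e4 := norm_inner_le_norm (𝕜 := ℂ) ((q m).1 - (q n).1) ((q m).2 - (q n).2)
    rw [← e3] at e4
    refine le_trans (le_of_eq ?_) e4
    norm_cast
    rw [abs_of_nonneg (by positivity)]
  have hc1 : CauchySeq fun n => (q n).1 := (hlim.fst_nhds).cauchySeq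
  have hc2 : CauchySeq fun n => (q n).2 := (hlim.snd_nhds).cauchySeq
  have hcau : ∀ g : ℕ → L2 Ω, (∀ m n, ‖g m - g n‖ ^ 2 ≤
      ‖(q m).1 - (q n).1‖ * ‖(q m).2 - (q n).2‖) → CauchySeq g := fun g hgn => by
    rw [Metric.cauchySeq_iff] at hc1 hc2 ⊢
    intro ε hε
    obtain ⟨N1, h1⟩ := hc1 ε hε
    obtain ⟨N2, h2⟩ := hc2 ε hε
    refine ⟨max N1 N2, fun m hm n hn => ?_⟩
    have a1 := h1 m (le_of_max_le_left hm) n (le_of_max_le_left hn)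
    have a2 := h2 m (le_of_max_le_right hm) n (le_of_max_le_right hn)
    rw [dist_eq_norm] at a1 a2 ⊢
    refine lt_of_pow_lt_pow_left₀ 2 hε.le ((hgn m n).trans_lt ?_)
    rw [sq]
    exact mul_lt_mul'' a1 a2 (norm_nonneg _) (norm_nonneg _)
  obtain ⟨k₁, hk₁⟩ := cauchySeq_tendsto_of_complete
    (hcau g₁ fun m n => le_trans (le_add_of_nonneg_right (by positivity)) (key m n))
  obtain ⟨k₂, hk₂⟩ := cauchySeq_tendsto_of_complete
    (hcau g₂ fun m n => le_trans (le_add_of_nonneg_left (by positivity)) (key m n))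
  refine ⟨k₁, k₂, ?_, fun v d₁ d₂ hv => ?_⟩
  · exact (Submodule.isClosed_topologicalClosure (testJets Ω D)).mem_of_tendsto
      (hlim.fst_nhds.prodMk_nhds (hk₁.prodMk_nhds hk₂)) (Filter.Eventually.of_forall hg)
  · refine tendsto_nhds_unique (((tendsto_const_nhds (x := d₁)).inner hk₁).add
      ((tendsto_const_nhds (x := d₂)).inner hk₂)) ?_
    refine ((tendsto_const_nhds (x := v)).inner hlim.snd_nhds).congr fun n => ?_
    exact (h n v d₁ d₂ hv).symm

/-- A complete orthogonal system of eigenfunctions whose eigenvalues accumulate only at infinity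
determines the spectrum with multiplicities. -/
theorem spectrumIs_of_orthogonal {ι : Type} {ev : ι → ℝ} {e : ι → L2 Ω}
    (hne : ∀ i, e i ≠ 0) (horth : Pairwise fun i j => inner ℂ (e i) (e j) = 0)
    (hcomplete : ∀ f, (∀ i, inner ℂ (e i) f = 0) → f = 0)
    (heig : ∀ i, (e i, (ev i : ℂ) • e i) ∈ mixedLaplacian Ω D)
    (hfin : ∀ C : ℝ, {i | ev i ≤ C}.Finite) : SpectrumIs Ω D ev := by
  let v : ι → L2 Ω := fun i => ((‖e i‖⁻¹ : ℝ) : ℂ) • e i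
  have hv : Orthonormal ℂ v := by
    refine ⟨fun i => ?_, fun i j hij => ?_⟩
    · have := norm_ne_zero_iff.2 (hne i)
      simp [v, norm_smul, this]
    · simp [v, inner_smul_left, inner_smul_right, horth hij]
  have hbot : (Submodule.span ℂ (Set.range v))ᗮ = ⊥ := by
    rw [eq_bot_iff]
    intro f hf
    refine hcomplete f fun i => ?_
    have h := (Submodule.mem_orthogonal _ _).1 hf (v i) (Submodule.subset_span ⟨i, rfl⟩)
    have := norm_ne_zero_iff.2 (hne i)
    simpa [v, inner_smul_left, hne i] using h
  let b := HilbertBasis.mkOfOrthogonalEqBot hv hbot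
  have hb : ∀ i, (b i, (ev i : ℂ) • b i) ∈ mixedLaplacian Ω D := fun i => by
    have h := (mixedLaplacian Ω D).smul_mem ((‖e i‖⁻¹ : ℝ) : ℂ) (heig i)
    have e1 : b i = ((‖e i‖⁻¹ : ℝ) : ℂ) • e i := by simp [b, v]
    rw [e1, smul_comm]
    exact h
  have hfin' : ∀ z : ℂ, {i | (ev i : ℂ) = z}.Finite := fun z =>
    (hfin z.re).subset fun i hi => by
      have : (ev i : ℂ) = z := hi
      simp [← this]
  refine ⟨?_, fun z => mixedLaplacian_symm.finrank_eigenspace hb (hfin' z)⟩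
  ext z
  rw [mixedSpectrum, Set.mem_ofPred_eq,
    mixedLaplacian_symm.exists_resolvent_iff isClosed_mixedLaplacian hb hfin, not_not]

end MixedLaplacian

/-! ### Partial derivatives of smooth functions -/

section PartialDerivatives

variable {E : Type*} [NormedAddCommGroup E] [NormedSpace ℝ E]

/-- The partial derivative `∂u/∂x`. -/
noncomputable def pdx (u : ℝ × ℝ → E) (p : ℝ × ℝ) : E := fderiv ℝ u p (1, 0)

/-- The partial derivative `∂u/∂y`. -/
noncomputable def pdy (u : ℝ × ℝ → E) (p : ℝ × ℝ) : E := fderiv ℝ u p (0, 1)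

variable {u : ℝ × ℝ → E}

theorem ContDiff.pdx (hu : ContDiff ℝ ∞ u) : ContDiff ℝ ∞ (pdx u) :=
  (hu.fderiv_right (m := ∞) (by simp)).clm_apply contDiff_const

theorem ContDiff.pdy (hu : ContDiff ℝ ∞ u) : ContDiff ℝ ∞ (pdy u) :=
  (hu.fderiv_right (m := ∞) (by simp)).clm_apply contDiff_const

theorem hasDerivAt_pdx {x y : ℝ} (hu : ContDiff ℝ ∞ u) :
    HasDerivAt (fun t => u (t, y)) (pdx u (x, y)) x := by
  have h1 := (hu.differentiable (by simp) (x, y)).hasFDerivAt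
  have h2 : HasDerivAt (fun t : ℝ => (t, y)) ((1 : ℝ), (0 : ℝ)) x :=
    (hasDerivAt_id x).prodMk (hasDerivAt_const x y)
  exact h1.comp_hasDerivAt x h2

theorem hasDerivAt_pdy {x y : ℝ} (hu : ContDiff ℝ ∞ u) :
    HasDerivAt (fun t => u (x, t)) (pdy u (x, y)) y := by
  have h1 := (hu.differentiable (by simp) (x, y)).hasFDerivAt
  have h2 : HasDerivAt (fun t : ℝ => (x, t)) ((0 : ℝ), (1 : ℝ)) y :=
    (hasDerivAt_const y x).prodMk (hasDerivAt_id y)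
  exact h1.comp_hasDerivAt y h2

theorem pdx_eq_of_hasDerivAt {x y : ℝ} {d : E} (hu : ContDiff ℝ ∞ u)
    (h : HasDerivAt (fun t => u (t, y)) d x) : pdx u (x, y) = d :=
  (hasDerivAt_pdx hu).unique h

theorem pdy_eq_of_hasDerivAt {x y : ℝ} {d : E} (hu : ContDiff ℝ ∞ u)
    (h : HasDerivAt (fun t => u (x, t)) d y) : pdy u (x, y) = d :=
  (hasDerivAt_pdy hu).unique h

end PartialDerivatives

/-! ### Derivatives vanish almost everywhere on the zero set -/

section CountableZeros

/-- A zero with nonzero derivative is isolated, and a discrete subset of the line is countable. -/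
theorem countable_zeros_of_deriv_ne_zero {g g' : ℝ → ℝ} (hg : ∀ x, HasDerivAt g (g' x) x) :
    {x | g x = 0 ∧ g' x ≠ 0}.Countable := by
  have : DiscreteTopology {x | g x = 0 ∧ g' x ≠ 0} := by
    rw [discreteTopology_subtype_iff]
    rintro x ⟨-, hx⟩
    have h := (hg x).eventually_ne (c := 0) hx
    rw [← disjoint_iff, Filter.disjoint_principal_right]
    filter_upwards [h] with t ht ht'
    exact ht ht'.1
  exact Set.countable_coe_iff.1 (TopologicalSpace.separableSpace_iff_countable.1 inferInstance)

/-- By Fubini, since each horizontal line meets the exceptional set in a countable set. This handles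
the points where the truncated gradients below need not converge by themselves. -/
theorem ae_pdx_eq_zero {u : ℝ × ℝ → ℝ} (hu : ContDiff ℝ ∞ u) :
    ∀ᵐ p : ℝ × ℝ, u p = 0 → pdx u p = 0 := by
  have hm : MeasurableSet {p : ℝ × ℝ | u p = 0 ∧ pdx u p ≠ 0} :=
    (hu.continuous.measurable (measurableSet_singleton 0)).inter
      ((hu.pdx.continuous.measurable (measurableSet_singleton 0)).compl)
  have h0 : volume {p : ℝ × ℝ | u p = 0 ∧ pdx u p ≠ 0} = 0 := by
    rw [Measure.volume_eq_prod, Measure.prod_apply_symm hm]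
    refine (lintegral_congr fun y => ?_).trans lintegral_zero
    exact (countable_zeros_of_deriv_ne_zero (g := fun t => u (t, y))
      (fun x => hasDerivAt_pdx hu)).measure_zero _
  filter_upwards [measure_eq_zero_iff_ae_notMem.1 h0] with p hp h
  by_contra h'
  exact hp ⟨h, h'⟩

theorem ae_pdy_eq_zero {u : ℝ × ℝ → ℝ} (hu : ContDiff ℝ ∞ u) :
    ∀ᵐ p : ℝ × ℝ, u p = 0 → pdy u p = 0 := by
  have hm : MeasurableSet {p : ℝ × ℝ | u p = 0 ∧ pdy u p ≠ 0} :=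
    (hu.continuous.measurable (measurableSet_singleton 0)).inter
      ((hu.pdy.continuous.measurable (measurableSet_singleton 0)).compl)
  have h0 : volume {p : ℝ × ℝ | u p = 0 ∧ pdy u p ≠ 0} = 0 := by
    rw [Measure.volume_eq_prod, Measure.prod_apply hm]
    refine (lintegral_congr fun x => ?_).trans lintegral_zero
    exact (countable_zeros_of_deriv_ne_zero (g := fun t => u (x, t))
      (fun y => hasDerivAt_pdy hu)).measure_zero _
  filter_upwards [measure_eq_zero_iff_ae_notMem.1 h0] with p hp h
  by_contra h'
  exact hp ⟨h, h'⟩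

end CountableZeros

/-! ### Continuous functions as elements of `L²(Ω)` -/

section ContinuousInL2

variable {Ω : Set (ℝ × ℝ)}

theorem integrableOn_of_isBounded {E : Type*} [NormedAddCommGroup E] {f : ℝ × ℝ → E}
    (hΩ : Bornology.IsBounded Ω) (hf : Continuous f) : IntegrableOn f Ω :=
  (hf.continuousOn.integrableOn_compact hΩ.isCompact_closure).mono_set subset_closure

theorem exists_norm_le_of_isBounded {E : Type*} [NormedAddCommGroup E] {f : ℝ × ℝ → E}
    (hΩ : Bornology.IsBounded Ω) (hf : Continuous f) : ∃ C, ∀ p ∈ Ω, ‖f p‖ ≤ C := by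
  obtain ⟨C, hC⟩ := hΩ.isCompact_closure.exists_bound_of_continuousOn hf.continuousOn
  exact ⟨C, fun p hp => hC p (subset_closure hp)⟩

theorem isFiniteMeasure_restrict_of_isBounded (hΩ : Bornology.IsBounded Ω) :
    IsFiniteMeasure ((volume : Measure (ℝ × ℝ)).restrict Ω) :=
  ⟨by rw [Measure.restrict_apply_univ]; exact hΩ.measure_lt_top⟩

theorem memLp_ofReal_of_isBounded {u : ℝ × ℝ → ℝ} (hΩ : Bornology.IsBounded Ω)
    (hu : Continuous u) :
    MemLp (fun p => (u p : ℂ)) 2 ((volume : Measure (ℝ × ℝ)).restrict Ω) := by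
  have hu' : Continuous fun p => (u p : ℂ) := Complex.continuous_ofReal.comp hu
  have hc := hΩ.isCompact_closure
  obtain ⟨C, hC⟩ := hc.exists_bound_of_continuousOn hu'.continuousOn
  have := isFiniteMeasure_restrict_of_isBounded hΩ.closure
  refine MemLp.mono_measure (Measure.restrict_mono subset_closure le_rfl)
    (MemLp.of_bound hu'.aestronglyMeasurable C ?_)
  exact (ae_restrict_iff' isClosed_closure.measurableSet).2 (ae_of_all _ hC)

/-- The class in `L²(Ω)` of a real continuous function on the plane. -/
noncomputable def toL2 (hΩ : Bornology.IsBounded Ω) (u : ℝ × ℝ → ℝ) (hu : Continuous u) : L2 Ω :=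
  (memLp_ofReal_of_isBounded hΩ hu).toLp _

theorem coeFn_toL2 (hΩ : Bornology.IsBounded Ω) {u : ℝ × ℝ → ℝ} (hu : Continuous u) :
    ∀ᵐ p ∂((volume : Measure (ℝ × ℝ)).restrict Ω), toL2 hΩ u hu p = (u p : ℂ) :=
  MemLp.coeFn_toLp _

/-- Dominated convergence for `‖f n - g‖²`: a constant is an integrable majorant because `Ω` is
bounded. -/
theorem tendsto_toL2 (hΩ : Bornology.IsBounded Ω) (ho : IsOpen Ω) {f : ℕ → ℝ × ℝ → ℝ}
    {g : ℝ × ℝ → ℝ} (hf : ∀ n, Continuous (f n)) (hg : Continuous g) (C : ℝ)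
    (hC : ∀ n, ∀ p ∈ Ω, |f n p| ≤ C)
    (hlim : ∀ᵐ p ∂((volume : Measure (ℝ × ℝ)).restrict Ω),
      Filter.Tendsto (fun n => f n p) Filter.atTop (nhds (g p))) :
    Filter.Tendsto (fun n => toL2 hΩ (f n) (hf n)) Filter.atTop (nhds (toL2 hΩ g hg)) := by
  have := isFiniteMeasure_restrict_of_isBounded hΩ
  have hae : ∀ᵐ p ∂((volume : Measure (ℝ × ℝ)).restrict Ω), p ∈ Ω :=
    ae_restrict_mem ho.measurableSet
  refine (Lp.tendsto_Lp_iff_tendsto_eLpNorm'' _ _ _ _).2 ?_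
  have hm : ∀ n, Continuous fun p => ‖(f n p : ℂ) - g p‖ₑ ^ (2 : ℝ) := fun n =>
    ENNReal.continuous_rpow_const.comp (((Complex.continuous_ofReal.comp (hf n)).sub
      (Complex.continuous_ofReal.comp hg)).enorm)
  obtain ⟨C', hC'⟩ := exists_norm_le_of_isBounded hΩ hg
  have key : Filter.Tendsto
      (fun n => ∫⁻ p in Ω, ‖(f n p : ℂ) - g p‖ₑ ^ (2 : ℝ)) Filter.atTop (nhds 0) := by
    rw [← lintegral_zero (μ := (volume : Measure (ℝ × ℝ)).restrict Ω)]
    refine tendsto_lintegral_of_dominated_convergence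
      (fun _ => (ENNReal.ofReal (C + C')) ^ (2 : ℝ)) (fun n => (hm n).measurable) (fun n => ?_) ?_ ?_
    · filter_upwards [hae] with p hp
      refine ENNReal.rpow_le_rpow ?_ (by norm_num)
      rw [← ofReal_norm]
      refine ENNReal.ofReal_le_ofReal ((norm_sub_le _ _).trans (add_le_add ?_ ?_))
      · simpa using hC n p hp
      · simpa using hC' p hp
    · rw [lintegral_const]
      exact ENNReal.mul_ne_top (ENNReal.rpow_ne_top_of_nonneg (by norm_num) ENNReal.ofReal_ne_top)
        (measure_ne_top _ _)
    · filter_upwards [hlim] with p hp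
      have h1 : Filter.Tendsto (fun n => (f n p : ℂ) - g p) Filter.atTop (nhds 0) := by
        rw [← sub_self (g p : ℂ)]
        exact ((Complex.continuous_ofReal.tendsto _).comp hp).sub_const _
      have h2 := (ENNReal.continuous_rpow_const (y := 2)).tendsto _ |>.comp h1.enorm
      simpa [Function.comp_def] using h2
  have h3 := (ENNReal.continuous_rpow_const (y := 1 / 2)).tendsto _ |>.comp key
  simp only [Function.comp_def] at h3
  rw [ENNReal.zero_rpow_of_pos (by norm_num)] at h3
  refine h3.congr fun n => ?_
  rw [eLpNorm_eq_lintegral_rpow_enorm_toReal (by norm_num) (by norm_num)]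
  simp

end ContinuousInL2

/-! ### Smooth truncation of small values -/

section Truncation

/-- A smooth function which vanishes near `0` and is the identity away from `0`. -/
noncomputable def smoothTrunc (s : ℝ) : ℝ := s * Real.smoothTransition (s ^ 2 - 1)

theorem contDiff_smoothTrunc : ContDiff ℝ ∞ smoothTrunc :=
  contDiff_id.mul (Real.smoothTransition.contDiff.comp ((contDiff_id.pow 2).sub contDiff_const))

theorem smoothTrunc_of_abs_le {s : ℝ} (h : |s| ≤ 1) : smoothTrunc s = 0 := by
  rw [smoothTrunc, Real.smoothTransition.zero_of_nonpos, mul_zero]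
  have := (sq_le_one_iff_abs_le_one s).2 h
  linarith

/-- The transition is complete once `s² - 1 ≥ 1`; `3 / 2` is a rational bound above `√2`. -/
theorem smoothTrunc_of_le_abs {s : ℝ} (h : 3 / 2 ≤ |s|) : smoothTrunc s = s := by
  rw [smoothTrunc, Real.smoothTransition.one_of_one_le, mul_one]
  rw [← sq_abs]
  nlinarith

/-- The threshold `2 > 3 / 2` leaves a neighbourhood on which the truncation is the identity. -/
theorem deriv_smoothTrunc_of_le_abs {s : ℝ} (h : 2 ≤ |s|) : deriv smoothTrunc s = 1 := by
  have : smoothTrunc =ᶠ[nhds s] id := by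
    have ho : IsOpen {t : ℝ | 3 / 2 < |t|} := isOpen_lt continuous_const continuous_abs
    filter_upwards [ho.mem_nhds (show 3 / 2 < |s| by linarith)] with t ht
    exact smoothTrunc_of_le_abs ht.le
  rw [this.deriv_eq]
  simp

theorem exists_abs_deriv_smoothTrunc_le : ∃ C, ∀ s, |deriv smoothTrunc s| ≤ C := by
  have hc : Continuous (deriv smoothTrunc) := contDiff_smoothTrunc.continuous_deriv (by simp)
  obtain ⟨C, hC⟩ := (isCompact_Icc (a := (-2 : ℝ)) (b := 2)).exists_bound_of_continuousOn
    hc.continuousOn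
  refine ⟨max C 1, fun s => ?_⟩
  by_cases h : |s| ≤ 2
  · exact (hC s (abs_le.1 h)).trans (le_max_left _ _)
  · rw [deriv_smoothTrunc_of_le_abs (le_of_not_ge h)]
    simp

theorem abs_smoothTrunc_le (s : ℝ) : |smoothTrunc s| ≤ |s| := by
  rw [smoothTrunc, abs_mul]
  refine mul_le_of_le_one_right (abs_nonneg _) ?_
  rw [abs_of_nonneg (Real.smoothTransition.nonneg _)]
  exact Real.smoothTransition.le_one _

theorem tendsto_natCast_succ_mul_abs {t : ℝ} (ht : t ≠ 0) (c : ℝ) :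
    ∀ᶠ n : ℕ in Filter.atTop, c ≤ |((n : ℝ) + 1) * t| := by
  have h1 : Filter.Tendsto (fun n : ℕ => ((n : ℝ) + 1) * |t|) Filter.atTop Filter.atTop :=
    (Filter.tendsto_atTop_add_const_right _ 1 tendsto_natCast_atTop_atTop).atTop_mul_const
      (abs_pos.2 ht)
  filter_upwards [h1.eventually_ge_atTop c] with n hn
  rwa [abs_mul, abs_of_pos (by positivity)]

/-- The truncation `smoothTrunc` at scale `1 / (n + 1)`. -/
noncomputable def truncAt (n : ℕ) (t : ℝ) : ℝ := smoothTrunc (((n : ℝ) + 1) * t) / ((n : ℝ) + 1)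

theorem contDiff_truncAt (n : ℕ) : ContDiff ℝ ∞ (truncAt n) :=
  (contDiff_smoothTrunc.comp (contDiff_const.mul contDiff_id)).div_const _

theorem hasDerivAt_truncAt (n : ℕ) (t : ℝ) :
    HasDerivAt (truncAt n) (deriv smoothTrunc (((n : ℝ) + 1) * t)) t := by
  have h1 := (contDiff_smoothTrunc.differentiable (by simp) (((n : ℝ) + 1) * t)).hasDerivAt
  have h2 := (h1.comp t ((hasDerivAt_id t).const_mul ((n : ℝ) + 1))).div_const ((n : ℝ) + 1)
  refine HasDerivAt.congr_deriv (f := truncAt n) h2 ?_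
  have : (n : ℝ) + 1 ≠ 0 := by positivity
  rw [mul_one, mul_div_cancel_right₀ _ this]

theorem abs_truncAt_le (n : ℕ) (t : ℝ) : |truncAt n t| ≤ |t| := by
  have h : (0 : ℝ) < (n : ℝ) + 1 := by positivity
  rw [truncAt, abs_div, abs_of_pos h, div_le_iff₀ h]
  refine (abs_smoothTrunc_le _).trans (le_of_eq ?_)
  rw [abs_mul, abs_of_pos h, mul_comm]

theorem tendsto_truncAt (t : ℝ) :
    Filter.Tendsto (fun n => truncAt n t) Filter.atTop (nhds t) := by
  by_cases ht : t = 0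
  · subst ht
    simp [truncAt, smoothTrunc]
  · refine tendsto_const_nhds.congr' ?_
    filter_upwards [tendsto_natCast_succ_mul_abs ht (3 / 2)] with n hn
    rw [truncAt, smoothTrunc_of_le_abs hn]
    have : (n : ℝ) + 1 ≠ 0 := by positivity
    field_simp

theorem tendsto_deriv_truncAt {t : ℝ} (ht : t ≠ 0) :
    Filter.Tendsto (fun n : ℕ => deriv smoothTrunc (((n : ℝ) + 1) * t)) Filter.atTop
      (nhds 1) := by
  refine tendsto_const_nhds.congr' ?_
  filter_upwards [tendsto_natCast_succ_mul_abs ht 2] with n hn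
  rw [deriv_smoothTrunc_of_le_abs hn]

theorem truncAt_of_abs_le {n : ℕ} {t : ℝ} (h : |t| ≤ 1 / ((n : ℝ) + 1)) : truncAt n t = 0 := by
  have h0 : (0 : ℝ) < (n : ℝ) + 1 := by positivity
  rw [truncAt, smoothTrunc_of_abs_le, zero_div]
  rw [abs_mul, abs_of_pos h0]
  rwa [le_div_iff₀ h0, mul_comm] at h

end Truncation

/-! ### Smooth functions vanishing on `D` lie in the form domain -/

section SmoothInSobolev

variable {Ω D : Set (ℝ × ℝ)}

/-- A smooth function vanishing on `D` belongs to `H¹_D(Ω)`. -/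
theorem jet_mem_sobolevD (hΩ : Bornology.IsBounded Ω) (ho : IsOpen Ω) {u : ℝ × ℝ → ℝ}
    (hu : ContDiff ℝ ∞ u) (hD : ∀ p ∈ D, u p = 0) :
    (toL2 hΩ u hu.continuous, toL2 hΩ (pdx u) hu.pdx.continuous,
      toL2 hΩ (pdy u) hu.pdy.continuous) ∈ sobolevD Ω D := by
  have hD' : ∀ p ∈ closure D, u p = 0 := fun p hp =>
    closure_minimal (t := {p | u p = 0}) hD (isClosed_eq hu.continuous continuous_const) hp
  obtain ⟨r, hr⟩ := hΩ.subset_ball (0 : ℝ × ℝ)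
  -- A cutoff equal to `1` on a ball containing `Ω` supplies compact support without changing jets
  -- on `Ω`.
  let χ : ContDiffBump (0 : ℝ × ℝ) := ⟨max r 1, max r 1 + 1, by positivity, by linarith⟩
  have hχ : ∀ p ∈ Ω, ∀ᶠ q in nhds p, χ q = 1 := fun p hp =>
    χ.eventuallyEq_one_of_mem_ball (Metric.ball_subset_ball (le_max_left r 1) (hr hp))
  -- The chain rule factor: the gradient of `truncAt n ∘ u` is `c n` times that of `u`.
  let c : ℕ → ℝ × ℝ → ℝ := fun n p => deriv smoothTrunc (((n : ℝ) + 1) * u p)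
  have hdc : Continuous (deriv smoothTrunc) := contDiff_smoothTrunc.continuous_deriv (by simp)
  have hcc : ∀ n, Continuous (c n) := fun n => hdc.comp (continuous_const.mul hu.continuous)
  have htc : ∀ n, Continuous fun p => truncAt n (u p) := fun n =>
    (contDiff_truncAt n).continuous.comp hu.continuous
  let w : ℕ → L2 Ω × L2 Ω × L2 Ω := fun n =>
    (toL2 hΩ (fun p => truncAt n (u p)) (htc n),
      toL2 hΩ (fun p => c n p * pdx u p) ((hcc n).mul hu.pdx.continuous),
      toL2 hΩ (fun p => c n p * pdy u p) ((hcc n).mul hu.pdy.continuous))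
  have hae : ∀ᵐ p ∂((volume : Measure (ℝ × ℝ)).restrict Ω), p ∈ Ω :=
    ae_restrict_mem ho.measurableSet
  have hw : ∀ n, w n ∈ testJets Ω D := fun n => by
    let φ : ℝ × ℝ → ℂ := fun p => ((χ p * truncAt n (u p) : ℝ) : ℂ)
    have hd : ∀ p ∈ Ω, ∀ v, fderiv ℝ φ p v = ((c n p * fderiv ℝ u p v : ℝ) : ℂ) :=
      fun p hp v => by
      have h1 : φ =ᶠ[nhds p] fun q => ((truncAt n (u q) : ℝ) : ℂ) := by
        filter_upwards [hχ p hp] with q hq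
        simp [φ, hq]
      have h2 : HasFDerivAt (fun q => truncAt n (u q)) (c n p • fderiv ℝ u p) p :=
        (hasDerivAt_truncAt n (u p)).comp_hasFDerivAt p
          (hu.differentiable (by simp) p).hasFDerivAt
      have h3 := Complex.ofRealCLM.hasFDerivAt.comp p h2
      rw [h1.fderiv_eq]
      change fderiv ℝ (Complex.ofRealCLM ∘ fun q => truncAt n (u q)) p v = _
      rw [h3.fderiv]
      simp
    refine ⟨φ, ⟨?_, ?_, ?_⟩, ?_, ?_, ?_⟩
    · exact Complex.ofRealCLM.contDiff.comp (χ.contDiff.mul ((contDiff_truncAt n).comp hu))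
    · exact (χ.hasCompactSupport.mul_right (f' := fun p => truncAt n (u p))).comp_left
        (g := Complex.ofReal) Complex.ofReal_zero
    -- This closed set contains the support and misses `closure D`, where `u = 0`.
    · have hs : tsupport φ ⊆ {p | 1 / ((n : ℝ) + 1) ≤ |u p|} := by
        refine closure_minimal (fun p hp => ?_)
          (isClosed_le continuous_const hu.continuous.abs)
        by_contra hlt
        exact hp (by simp [φ, truncAt_of_abs_le (le_of_not_ge hlt)])
      refine Set.disjoint_left.2 fun p hp hpD => ?_
      have h1 : 1 / ((n : ℝ) + 1) ≤ |u p| := hs hp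
      rw [hD' p hpD, abs_zero] at h1
      have : 0 < 1 / ((n : ℝ) + 1) := by positivity
      linarith
    · filter_upwards [hae, coeFn_toL2 hΩ (htc n)] with p hp h
      rw [h]
      simp [φ, (hχ p hp).self_of_nhds]
    · filter_upwards [hae, coeFn_toL2 hΩ ((hcc n).mul hu.pdx.continuous)] with p hp h
      rw [hd p hp]
      exact h
    · filter_upwards [hae, coeFn_toL2 hΩ ((hcc n).mul hu.pdy.continuous)] with p hp h
      rw [hd p hp]
      exact h
  obtain ⟨C, hC⟩ := exists_abs_deriv_smoothTrunc_le
  obtain ⟨C₀, hC₀⟩ := exists_norm_le_of_isBounded hΩ hu.continuous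
  obtain ⟨C₁, hC₁⟩ := exists_norm_le_of_isBounded hΩ hu.pdx.continuous
  obtain ⟨C₂, hC₂⟩ := exists_norm_le_of_isBounded hΩ hu.pdy.continuous
  -- Where `u ≠ 0` the factor `c n` tends to `1`; where `u = 0` it need not, but there `d = 0`
  -- almost everywhere.
  have hlim : ∀ {d : ℝ × ℝ → ℝ}, (∀ᵐ p : ℝ × ℝ, u p = 0 → d p = 0) →
      ∀ᵐ p ∂((volume : Measure (ℝ × ℝ)).restrict Ω),
        Filter.Tendsto (fun n => c n p * d p) Filter.atTop (nhds (d p)) := fun {d} hd => by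
    filter_upwards [ae_restrict_of_ae hd] with p hp
    by_cases h : u p = 0
    · simp [hp h]
    · simpa using (tendsto_deriv_truncAt h).mul_const (d p)
  have hbound : ∀ {d : ℝ × ℝ → ℝ} {K : ℝ}, (∀ p ∈ Ω, ‖d p‖ ≤ K) →
      ∀ n, ∀ p ∈ Ω, |c n p * d p| ≤ C * K := fun {d K} hd n p hp => by
    rw [abs_mul]
    exact mul_le_mul (hC _) (hd p hp) (abs_nonneg _) ((abs_nonneg _).trans (hC 0))
  refine mem_closure_of_tendsto (f := w) (b := Filter.atTop) ?_ (Filter.Eventually.of_forall hw)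
  refine Filter.Tendsto.prodMk_nhds ?_ (Filter.Tendsto.prodMk_nhds ?_ ?_)
  · exact tendsto_toL2 hΩ ho _ _ C₀ (fun n p hp => (abs_truncAt_le _ _).trans (hC₀ p hp))
      (ae_of_all _ fun p => tendsto_truncAt _)
  · exact tendsto_toL2 hΩ ho _ _ _ (hbound hC₁) (hlim (ae_pdx_eq_zero hu))
  · exact tendsto_toL2 hΩ ho _ _ _ (hbound hC₂) (hlim (ae_pdy_eq_zero hu))

end SmoothInSobolev

/-! ### Integration by parts along slices -/

section WeakForm

variable {Ω D : Set (ℝ × ℝ)}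

theorem integral_indicator_slice_eq_zero {g g' : ℝ → ℂ} {s : Set ℝ} (hg' : Continuous g')
    (hg : ∀ x, HasDerivAt g (g' x) x)
    (hs : (∀ x, x ∉ s) ∨ ∃ a b, a ≤ b ∧ s = Set.Ioo a b ∧ g a = 0 ∧ g b = 0) :
    ∫ x, s.indicator g' x = 0 := by
  rcases hs with hs | ⟨a, b, hab, rfl, ha, hb⟩
  · rw [Set.eq_empty_iff_forall_notMem.2 hs]
    simp
  · rw [integral_indicator measurableSet_Ioo, ← integral_Ioc_eq_integral_Ioo,
      ← intervalIntegral.integral_of_le hab,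
      intervalIntegral.integral_eq_sub_of_hasDerivAt (fun x _ => hg x)
        (hg'.intervalIntegrable _ _), ha, hb, sub_self]

/-- Fubini and the fundamental theorem of calculus on each horizontal slice; no boundary regularity
enters. -/
theorem setIntegral_pdx_eq_zero (hΩ : Bornology.IsBounded Ω) (ho : IsOpen Ω) {F : ℝ × ℝ → ℂ}
    (hF : ContDiff ℝ ∞ F)
    (hs : ∀ y, (∀ x, (x, y) ∉ Ω) ∨ ∃ a b, a ≤ b ∧ {x | (x, y) ∈ Ω} = Set.Ioo a b ∧
      F (a, y) = 0 ∧ F (b, y) = 0) : ∫ p in Ω, pdx F p = 0 := by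
  have hi := integrableOn_of_isBounded hΩ hF.pdx.continuous
  rw [← integrable_indicator_iff ho.measurableSet] at hi
  rw [← integral_indicator ho.measurableSet, Measure.volume_eq_prod, integral_prod_symm _ hi]
  refine (integral_congr_ae (ae_of_all _ fun y => ?_)).trans (integral_zero _ _)
  exact integral_indicator_slice_eq_zero (s := {x | (x, y) ∈ Ω}) (g := fun x => F (x, y))
    (g' := fun x => pdx F (x, y)) (hF.pdx.continuous.comp (by fun_prop))
    (fun x => hasDerivAt_pdx hF) (hs y)

theorem setIntegral_pdy_eq_zero (hΩ : Bornology.IsBounded Ω) (ho : IsOpen Ω) {F : ℝ × ℝ → ℂ}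
    (hF : ContDiff ℝ ∞ F)
    (hs : ∀ x, (∀ y, (x, y) ∉ Ω) ∨ ∃ a b, a ≤ b ∧ {y | (x, y) ∈ Ω} = Set.Ioo a b ∧
      F (x, a) = 0 ∧ F (x, b) = 0) : ∫ p in Ω, pdy F p = 0 := by
  have hi := integrableOn_of_isBounded hΩ hF.pdy.continuous
  rw [← integrable_indicator_iff ho.measurableSet] at hi
  rw [← integral_indicator ho.measurableSet, Measure.volume_eq_prod, integral_prod _ hi]
  refine (integral_congr_ae (ae_of_all _ fun x => ?_)).trans (integral_zero _ _)
  exact integral_indicator_slice_eq_zero (s := {y | (x, y) ∈ Ω}) (g := fun y => F (x, y))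
    (g' := fun y => pdy F (x, y)) (hF.pdy.continuous.comp (by fun_prop))
    (fun y => hasDerivAt_pdy hF) (hs x)

theorem inner_toL2 (hΩ : Bornology.IsBounded Ω) {φ : ℝ × ℝ → ℂ} {u : ℝ × ℝ → ℝ}
    (hu : Continuous u) {w : L2 Ω}
    (hw : ∀ᵐ p ∂((volume : Measure (ℝ × ℝ)).restrict Ω), w p = φ p) :
    inner ℂ w (toL2 hΩ u hu) = ∫ p in Ω, star (φ p) * u p := by
  rw [L2.inner_def]
  refine integral_congr_ae ?_
  filter_upwards [hw, coeFn_toL2 hΩ hu] with p h1 h2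
  rw [h1, h2, RCLike.inner_apply, mul_comm]
  rfl

/-- A smooth solution of `-Δu = λu`, vanishing on `D`, is an eigenfunction of the mixed Laplacian if
each horizontal and each vertical slice of `Ω` is an interval, at both ends of which either the
boundary belongs to the closure of `D` or the derivative of `u` along the slice vanishes. -/
theorem mem_mixedLaplacian_of_slices (hΩ : Bornology.IsBounded Ω) (ho : IsOpen Ω)
    {u : ℝ × ℝ → ℝ} (hu : ContDiff ℝ ∞ u) (hD : ∀ p ∈ D, u p = 0) {c : ℝ}
    (hΔ : ∀ p, pdx (pdx u) p + pdy (pdy u) p = -(c * u p))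
    (hx : ∀ y, (∀ x, (x, y) ∉ Ω) ∨ ∃ a b, a ≤ b ∧ {x | (x, y) ∈ Ω} = Set.Ioo a b ∧
      ((a, y) ∈ closure D ∨ pdx u (a, y) = 0) ∧ ((b, y) ∈ closure D ∨ pdx u (b, y) = 0))
    (hy : ∀ x, (∀ y, (x, y) ∉ Ω) ∨ ∃ a b, a ≤ b ∧ {y | (x, y) ∈ Ω} = Set.Ioo a b ∧
      ((x, a) ∈ closure D ∨ pdy u (x, a) = 0) ∧ ((x, b) ∈ closure D ∨ pdy u (x, b) = 0)) :
    (toL2 hΩ u hu.continuous, (c : ℂ) • toL2 hΩ u hu.continuous) ∈ mixedLaplacian Ω D := by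
  refine ⟨_, _, jet_mem_sobolevD hΩ ho hu hD, fun v d₁ d₂ hv => ?_⟩
  suffices h : ∀ w ∈ sobolevD Ω D,
      inner ℂ w.2.1 (toL2 hΩ (pdx u) hu.pdx.continuous) +
        inner ℂ w.2.2 (toL2 hΩ (pdy u) hu.pdy.continuous) =
      inner ℂ w.1 ((c : ℂ) • toL2 hΩ u hu.continuous) from h _ hv
  intro w hw
  -- Both sides are continuous in `w`, so the identity need only be checked on jets of test
  -- functions.
  refine closure_minimal (t := {w : L2 Ω × L2 Ω × L2 Ω |
      inner ℂ w.2.1 (toL2 hΩ (pdx u) hu.pdx.continuous) +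
        inner ℂ w.2.2 (toL2 hΩ (pdy u) hu.pdy.continuous) =
      inner ℂ w.1 ((c : ℂ) • toL2 hΩ u hu.continuous)}) ?_
    (isClosed_eq (by fun_prop) (by fun_prop)) hw
  rintro w ⟨φ, hφ, h0, h1, h2⟩
  have hφs := hφ.contDiff
  have hφD : ∀ p ∈ closure D, φ p = 0 := fun p hp =>
    image_eq_zero_of_notMem_tsupport fun h => Set.disjoint_left.1 hφ.disjoint h hp
  have hstar : ContDiff ℝ ∞ fun p => star (φ p) :=
    Complex.conjCLE.contDiff.comp hφs
  have hre : ∀ {d : ℝ × ℝ → ℝ}, ContDiff ℝ ∞ d → ContDiff ℝ ∞ fun p => (d p : ℂ) :=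
    fun hd => Complex.ofRealCLM.contDiff.comp hd
  -- The field `conj φ ∇u` has divergence `conj ∇φ · ∇u + conj φ Δu`. At each end of a slice, either
  -- `φ` or the derivative of `u` along the slice vanishes, so each component integrates to zero.
  have hF : ContDiff ℝ ∞ fun p => star (φ p) * ((pdx u p : ℝ) : ℂ) := hstar.mul (hre hu.pdx)
  have hG : ContDiff ℝ ∞ fun p => star (φ p) * ((pdy u p : ℝ) : ℂ) := hstar.mul (hre hu.pdy)
  have eF : ∀ p, pdx (fun p => star (φ p) * ((pdx u p : ℝ) : ℂ)) p =
      star (pdx φ p) * ((pdx u p : ℝ) : ℂ) + star (φ p) * ((pdx (pdx u) p : ℝ) : ℂ) := fun p =>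
    pdx_eq_of_hasDerivAt hF ((hasDerivAt_pdx hφs).star.mul (hasDerivAt_pdx hu.pdx).ofReal_comp)
  have eG : ∀ p, pdy (fun p => star (φ p) * ((pdy u p : ℝ) : ℂ)) p =
      star (pdy φ p) * ((pdy u p : ℝ) : ℂ) + star (φ p) * ((pdy (pdy u) p : ℝ) : ℂ) := fun p =>
    pdy_eq_of_hasDerivAt hG ((hasDerivAt_pdy hφs).star.mul (hasDerivAt_pdy hu.pdy).ofReal_comp)
  have iF : ∫ p in Ω, pdx (fun p => star (φ p) * ((pdx u p : ℝ) : ℂ)) p = 0 := by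
    refine setIntegral_pdx_eq_zero hΩ ho hF fun y => (hx y).imp_right ?_
    rintro ⟨a, b, hab, hs, ha, hb⟩
    refine ⟨a, b, hab, hs, ?_, ?_⟩
    · rcases ha with h | h <;> simp [h, hφD]
    · rcases hb with h | h <;> simp [h, hφD]
  have iG : ∫ p in Ω, pdy (fun p => star (φ p) * ((pdy u p : ℝ) : ℂ)) p = 0 := by
    refine setIntegral_pdy_eq_zero hΩ ho hG fun x => (hy x).imp_right ?_
    rintro ⟨a, b, hab, hs, ha, hb⟩
    refine ⟨a, b, hab, hs, ?_, ?_⟩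
    · rcases ha with h | h <;> simp [h, hφD]
    · rcases hb with h | h <;> simp [h, hφD]
  have cm : ∀ {ψ : ℝ × ℝ → ℂ} {d : ℝ × ℝ → ℝ}, ContDiff ℝ ∞ ψ → ContDiff ℝ ∞ d →
      IntegrableOn (fun p => star (ψ p) * (d p : ℂ)) Ω := fun hψ hd =>
    integrableOn_of_isBounded hΩ (hψ.continuous.star.mul (hre hd).continuous)
  change _ + _ = inner ℂ w.1 _
  rw [inner_smul_right, inner_toL2 hΩ hu.pdx.continuous (φ := pdx φ) h1,
    inner_toL2 hΩ hu.pdy.continuous (φ := pdy φ) h2, inner_toL2 hΩ hu.continuous h0]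
  simp only [eF] at iF
  simp only [eG] at iG
  rw [integral_add (cm hφs.pdx hu.pdx) (cm hφs hu.pdx.pdx)] at iF
  rw [integral_add (cm hφs.pdy hu.pdy) (cm hφs hu.pdy.pdy)] at iG
  have hsum : (∫ p in Ω, star (φ p) * ((pdx (pdx u) p : ℝ) : ℂ)) +
      (∫ p in Ω, star (φ p) * ((pdy (pdy u) p : ℝ) : ℂ)) = -(c * ∫ p in Ω, star (φ p) * (u p : ℂ)) := by
    rw [← integral_add (cm hφs hu.pdx.pdx) (cm hφs hu.pdy.pdy), ← integral_const_mul,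
      ← integral_neg]
    refine integral_congr_ae (ae_of_all _ fun p => ?_)
    have := congrArg (fun t : ℝ => (t : ℂ)) (hΔ p)
    push_cast at this
    simp only
    rw [← mul_add, this]
    ring
  linear_combination iF + iG - hsum

end WeakForm

/-! ### Completeness by Stone–Weierstrass -/

section Completeness

variable {Ω : Set (ℝ × ℝ)}

/-- If a space `W` of continuous functions is stable under multiplication by two functions which
together separate the points of `closure Ω`, and contains a function without zeros in `Ω`, then its
orthogonal complement in `L¹(Ω)` is trivial. -/
theorem ae_eq_zero_of_orthogonal (hΩ : Bornology.IsBounded Ω) (ho : IsOpen Ω) {f : ℝ × ℝ → ℂ}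
    (hf : IntegrableOn f Ω) {P Q w₀ : ℝ × ℝ → ℝ} (hP : Continuous P) (hQ : Continuous Q)
    (hsep : Set.InjOn (fun p => (P p, Q p)) (closure Ω))
    (W : Submodule ℝ (ℝ × ℝ → ℝ)) (hWP : ∀ w ∈ W, P * w ∈ W) (hWQ : ∀ w ∈ W, Q * w ∈ W)
    (hw₀ : w₀ ∈ W) (hc : Continuous w₀) (hne : ∀ p ∈ Ω, w₀ p ≠ 0)
    (hW : ∀ w ∈ W, ∫ p in Ω, w p • f p = 0) :
    ∀ᵐ p ∂((volume : Measure (ℝ × ℝ)).restrict Ω), f p = 0 := by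
  have hK := hΩ.isCompact_closure
  have : CompactSpace (closure Ω) := isCompact_iff_compactSpace.1 hK
  let P' : C(closure Ω, ℝ) := ⟨fun p => P p, hP.comp continuous_subtype_val⟩
  let Q' : C(closure Ω, ℝ) := ⟨fun p => Q p, hQ.comp continuous_subtype_val⟩
  let A := Algebra.adjoin ℝ ({P', Q'} : Set C(closure Ω, ℝ))
  have hA : A.SeparatesPoints := by
    intro p q hpq
    by_contra! h
    have hPQ : ∀ g ∈ ({P', Q'} : Set C(closure Ω, ℝ)), g p = g q := fun g hg =>
      h _ ⟨g, Algebra.subset_adjoin hg, rfl⟩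
    refine hpq (Subtype.ext (hsep p.2 q.2 (Prod.ext ?_ ?_)))
    · exact hPQ P' (by simp)
    · exact hPQ Q' (by simp)
  -- Stability under `P` and `Q` extends to the whole algebra they generate, up to agreement on
  -- `closure Ω`.
  have hmul : ∀ a ∈ A, ∀ w ∈ W, ∃ w' ∈ W, ∀ p : closure Ω, w' p = a p * w p := by
    intro a ha
    induction ha using Algebra.adjoin_induction with
    | mem a ha =>
      intro w hw
      rcases ha with rfl | rfl
      · exact ⟨P * w, hWP w hw, fun p => rfl⟩
      · exact ⟨Q * w, hWQ w hw, fun p => rfl⟩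
    | algebraMap r => exact fun w hw => ⟨r • w, W.smul_mem r hw, fun p => rfl⟩
    | add a b _ _ iha ihb =>
      intro w hw
      obtain ⟨w₁, h₁, e₁⟩ := iha w hw
      obtain ⟨w₂, h₂, e₂⟩ := ihb w hw
      exact ⟨w₁ + w₂, W.add_mem h₁ h₂, fun p => by simp [e₁, e₂, add_mul]⟩
    | mul a b _ _ iha ihb =>
      intro w hw
      obtain ⟨w₁, h₁, e₁⟩ := ihb w hw
      obtain ⟨w₂, h₂, e₂⟩ := iha w₁ h₁
      exact ⟨w₂, h₂, fun p => by simp [e₁, e₂, mul_assoc]⟩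
  have hae : ∀ᵐ p ∂((volume : Measure (ℝ × ℝ)).restrict Ω), p ∈ Ω :=
    ae_restrict_mem ho.measurableSet
  have hbd : ∀ {g : ℝ × ℝ → ℝ} {h : ℝ × ℝ → ℂ}, Continuous g → IntegrableOn h Ω →
      IntegrableOn (fun p => g p • h p) Ω := fun {g h} hg hh => by
    obtain ⟨C, hC⟩ := exists_norm_le_of_isBounded hΩ hg
    refine Integrable.bdd_smul hh C hg.aestronglyMeasurable ?_
    filter_upwards [hae] with p hp using hC p hp
  have hf₀ : IntegrableOn (fun p => w₀ p • f p) Ω := hbd hc hf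
  -- If `a ∈ A` is uniformly `ε`-close to `φ`, then `a w₀` agrees on `closure Ω` with an element of
  -- `W` and integrates to zero against `f`.
  have hzero : ∀ φ : ℝ × ℝ → ℝ, Continuous φ → ∫ p in Ω, φ p • w₀ p • f p = 0 := by
    intro φ hφ
    have hle : ∀ ε > 0, ‖∫ p in Ω, φ p • w₀ p • f p‖ ≤ ε * ∫ p in Ω, ‖w₀ p • f p‖ := by
      intro ε hε
      obtain ⟨⟨a, ha⟩, hlt⟩ :=
        ContinuousMap.exists_mem_subalgebra_near_continuousMap_of_separatesPoints A hA
          ⟨fun p => φ p, hφ.comp continuous_subtype_val⟩ ε hε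
      obtain ⟨w, hw, e⟩ := hmul a ha w₀ hw₀
      have hcw : ContinuousOn w (closure Ω) := by
        rw [continuousOn_iff_continuous_domRestrict]
        have : (closure Ω).domRestrict w = fun p => a p * w₀ p := funext e
        rw [this]
        exact a.continuous.mul (hc.comp continuous_subtype_val)
      have hwm : AEStronglyMeasurable w (volume.restrict Ω) :=
        (hcw.aestronglyMeasurable isClosed_closure.measurableSet).mono_measure
          (Measure.restrict_mono subset_closure le_rfl)
      obtain ⟨C, hC⟩ := hK.exists_bound_of_continuousOn hcw
      have hwi : IntegrableOn (fun p => w p • f p) Ω := by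
        refine Integrable.bdd_smul (φ := w) hf C hwm ?_
        filter_upwards [hae] with p hp using hC p (subset_closure hp)
      rw [← sub_zero (∫ p in Ω, φ p • w₀ p • f p), ← hW w hw,
        ← integral_sub (hbd hφ hf₀) hwi, ← integral_const_mul]
      refine norm_integral_le_of_norm_le (hf₀.norm.const_mul ε) ?_
      filter_upwards [hae] with p hp
      have e' := e ⟨p, subset_closure hp⟩
      simp only at e'
      rw [e', mul_smul, ← sub_smul, norm_smul]
      refine mul_le_mul_of_nonneg_right ?_ (norm_nonneg _)
      have h2 := ContinuousMap.norm_coe_le_norm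
        (a - ⟨fun p : closure Ω => φ p, hφ.comp continuous_subtype_val⟩) ⟨p, subset_closure hp⟩
      rw [norm_sub_rev]
      exact h2.trans hlt.le
    by_contra hne0
    have hpos := norm_pos_iff.2 hne0
    have hI : 0 ≤ ∫ p in Ω, ‖w₀ p • f p‖ := integral_nonneg fun _ => norm_nonneg _
    -- This `ε` makes the bound less than half the norm being bounded; the `+ 1` avoids division by
    -- zero.
    have := hle (‖∫ p in Ω, φ p • w₀ p • f p‖ / (2 * ((∫ p in Ω, ‖w₀ p • f p‖) + 1)))
      (by positivity)
    rw [div_mul_eq_mul_div, le_div_iff₀ (by positivity)] at this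
    nlinarith
  have hloc : LocallyIntegrableOn (fun p => w₀ p • f p) Ω volume := hf₀.locallyIntegrableOn
  have hz := ho.ae_eq_zero_of_integral_contDiff_smul_eq_zero hloc fun g hg _ hgs => by
    rw [← hzero g hg.continuous]
    refine (setIntegral_eq_integral_of_forall_compl_eq_zero fun p hp => ?_).symm
    rw [image_eq_zero_of_notMem_tsupport fun h => hp (hgs h), zero_smul]
  rw [ae_restrict_iff' ho.measurableSet]
  filter_upwards [hz] with p hp hpΩ
  exact (smul_eq_zero.1 (hp hpΩ)).resolve_left (hne p hpΩ)

end Completeness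

/-! ### Completeness of families of functions -/

section SpanCompleteness

variable {Ω : Set (ℝ × ℝ)}

theorem inner_toL2_left (hΩ : Bornology.IsBounded Ω) {u : ℝ × ℝ → ℝ} (hu : Continuous u)
    (f : L2 Ω) : inner ℂ (toL2 hΩ u hu) f = ∫ p in Ω, u p • f p := by
  rw [L2.inner_def]
  refine integral_congr_ae ?_
  filter_upwards [coeFn_toL2 hΩ hu] with p h
  rw [h, RCLike.inner_apply, mul_comm, Complex.real_smul]
  simp

theorem inner_toL2_toL2 (hΩ : Bornology.IsBounded Ω) {u v : ℝ × ℝ → ℝ} (hu : Continuous u)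
    (hv : Continuous v) :
    inner ℂ (toL2 hΩ u hu) (toL2 hΩ v hv) = ((∫ p in Ω, u p * v p : ℝ) : ℂ) := by
  rw [inner_toL2_left, ← integral_complex_ofReal]
  refine integral_congr_ae ?_
  filter_upwards [coeFn_toL2 hΩ hv] with p h
  rw [h, Complex.real_smul, Complex.ofReal_mul]

theorem mul_mem_span_range {κ : Type*} {g : κ → ℝ × ℝ → ℝ} {P : ℝ × ℝ → ℝ}
    (hP : ∀ i, P * g i ∈ Submodule.span ℝ (Set.range g)) :
    ∀ w ∈ Submodule.span ℝ (Set.range g), P * w ∈ Submodule.span ℝ (Set.range g) := by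
  intro w hw
  induction hw using Submodule.span_induction with
  | mem w hw => obtain ⟨i, rfl⟩ := hw; exact hP i
  | zero => simp
  | add v w _ _ hv hw => rw [mul_add]; exact Submodule.add_mem _ hv hw
  | smul c w _ hw => rw [mul_smul_comm]; exact Submodule.smul_mem _ c hw

/-- On a bounded set `L²` lies in `L¹`, so the density argument applies to `f`; stability of the
span is needed on generators only. -/
theorem eq_zero_of_orthogonal_span (hΩ : Bornology.IsBounded Ω) (ho : IsOpen Ω) {κ : Type*}
    {g : κ → ℝ × ℝ → ℝ} (hg : ∀ i, Continuous (g i)) {P Q : ℝ × ℝ → ℝ} (hP : Continuous P)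
    (hQ : Continuous Q) (hsep : Set.InjOn (fun p => (P p, Q p)) (closure Ω))
    (hPg : ∀ i, P * g i ∈ Submodule.span ℝ (Set.range g))
    (hQg : ∀ i, Q * g i ∈ Submodule.span ℝ (Set.range g)) (i₀ : κ) (hne : ∀ p ∈ Ω, g i₀ p ≠ 0)
    {f : L2 Ω} (hf : ∀ i, ∫ p in Ω, g i p • f p = 0) : f = 0 := by
  have := isFiniteMeasure_restrict_of_isBounded hΩ
  have hfi : Integrable f ((volume : Measure (ℝ × ℝ)).restrict Ω) :=
    (Lp.memLp f).integrable (by norm_num)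
  have hgi : ∀ {w : ℝ × ℝ → ℝ}, Continuous w →
      Integrable (fun p => w p • f p) ((volume : Measure (ℝ × ℝ)).restrict Ω) := fun {w} hw => by
    obtain ⟨C, hC⟩ := exists_norm_le_of_isBounded hΩ hw
    refine Integrable.bdd_smul (φ := w) hfi C hw.aestronglyMeasurable ?_
    filter_upwards [ae_restrict_mem ho.measurableSet] with p hp using hC p hp
  have hW : ∀ w ∈ Submodule.span ℝ (Set.range g), Continuous w ∧ ∫ p in Ω, w p • f p = 0 := by
    intro w hw
    induction hw using Submodule.span_induction with
    | mem w hw => obtain ⟨i, rfl⟩ := hw; exact ⟨hg i, hf i⟩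
    | zero => exact ⟨continuous_zero, by simp⟩
    | add v w _ _ hv hw =>
      refine ⟨hv.1.add hw.1, ?_⟩
      simp only [Pi.add_apply, add_smul]
      rw [integral_add (hgi hv.1) (hgi hw.1), hv.2, hw.2, add_zero]
    | smul c w _ hw =>
      refine ⟨hw.1.const_smul c, ?_⟩
      simp only [Pi.smul_apply, smul_assoc]
      rw [integral_smul, hw.2, smul_zero]
  have h0 := ae_eq_zero_of_orthogonal hΩ ho hfi hP hQ hsep (Submodule.span ℝ (Set.range g))
    (mul_mem_span_range hPg) (mul_mem_span_range hQg) (Submodule.subset_span ⟨i₀, rfl⟩) (hg i₀)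
    hne fun w hw => (hW w hw).2
  exact Lp.ext (Filter.EventuallyEq.trans h0 (Lp.coeFn_zero _ _ _).symm)

theorem finite_setOf_le {P : ℕ × ℕ → Prop} {ev : {p : ℕ × ℕ // P p} → ℝ}
    (h₁ : ∀ p, (p.1.1 : ℝ) ≤ ev p) (h₂ : ∀ p, (p.1.2 : ℝ) ≤ ev p) (C : ℝ) :
    {p | ev p ≤ C}.Finite := by
  refine Set.Finite.of_finite_image (f := Subtype.val) ?_ Subtype.val_injective.injOn
  refine ((Set.finite_Iic ⌊C⌋₊).prod (Set.finite_Iic ⌊C⌋₊)).subset ?_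
  rintro _ ⟨p, hp, rfl⟩
  exact ⟨Nat.le_floor ((h₁ p).trans hp), Nat.le_floor ((h₂ p).trans hp)⟩

end SpanCompleteness

/-! ### Integrals and recurrences of sines -/

section SineIntegrals

/-- The Wronskian of the two sines, divided by `α² - β²`, is a primitive. It vanishes at `0`, and
`h` says that it vanishes at `L`, which covers a common Dirichlet or a common Neumann condition
there. -/
theorem integral_sin_mul_sin_eq_zero {L α β : ℝ} (hne : α ^ 2 ≠ β ^ 2)
    (h : α * Real.cos (α * L) * Real.sin (β * L) = β * Real.sin (α * L) * Real.cos (β * L)) :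
    ∫ x in (0 : ℝ)..L, Real.sin (α * x) * Real.sin (β * x) = 0 := by
  have hne' : α ^ 2 - β ^ 2 ≠ 0 := sub_ne_zero.2 hne
  have hd : ∀ x ∈ Set.uIcc 0 L, HasDerivAt (fun x => (β * Real.sin (α * x) * Real.cos (β * x) -
      α * Real.cos (α * x) * Real.sin (β * x)) / (α ^ 2 - β ^ 2))
      (Real.sin (α * x) * Real.sin (β * x)) x := fun x _ => by
    have ha : HasDerivAt (fun x => α * x) α x := by simpa using (hasDerivAt_id x).const_mul α
    have hb : HasDerivAt (fun x => β * x) β x := by simpa using (hasDerivAt_id x).const_mul β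
    refine ((((ha.sin.const_mul β).mul hb.cos).sub
      ((ha.cos.const_mul α).mul hb.sin)).div_const _).congr_deriv ?_
    rw [div_eq_iff hne']
    ring
  rw [intervalIntegral.integral_eq_sub_of_hasDerivAt hd
    ((by fun_prop : Continuous fun x : ℝ => Real.sin (α * x) * Real.sin (β * x)).intervalIntegrable
      _ _)]
  simp [h]

theorem integral_sin_mul_self {L α : ℝ} (hα : α ≠ 0)
    (h : Real.sin (α * L) * Real.cos (α * L) = 0) :
    ∫ x in (0 : ℝ)..L, Real.sin (α * x) * Real.sin (α * x) = L / 2 := by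
  have hd : ∀ x ∈ Set.uIcc 0 L, HasDerivAt (fun x => x / 2 -
      Real.sin (α * x) * Real.cos (α * x) / (2 * α))
      (Real.sin (α * x) * Real.sin (α * x)) x := fun x _ => by
    have ha : HasDerivAt (fun x => α * x) α x := by simpa using (hasDerivAt_id x).const_mul α
    refine (((hasDerivAt_id x).div_const 2).sub
      ((ha.sin.mul ha.cos).div_const (2 * α))).congr_deriv ?_
    field_simp
    nlinarith [Real.sin_sq_add_cos_sq (α * x)]
  rw [intervalIntegral.integral_eq_sub_of_hasDerivAt hd
    ((by fun_prop : Continuous fun x : ℝ => Real.sin (α * x) * Real.sin (α * x)).intervalIntegrable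
      _ _)]
  simp [h]

theorem setIntegral_Ioo_prod_mul {L : ℝ} (hL : 0 ≤ L) (f g : ℝ → ℝ) :
    ∫ p in Set.Ioo 0 L ×ˢ Set.Ioo 0 L, f p.1 * g p.2 =
      (∫ x in (0 : ℝ)..L, f x) * ∫ y in (0 : ℝ)..L, g y := by
  rw [Measure.volume_eq_prod, setIntegral_prod_mul, intervalIntegral.integral_of_le hL,
    intervalIntegral.integral_of_le hL, integral_Ioc_eq_integral_Ioo,
    integral_Ioc_eq_integral_Ioo]

theorem cos_odd_mul_pi_div_two (k : ℤ) : Real.cos ((2 * k + 1) * (Real.pi / 2)) = 0 := by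
  rw [Real.cos_eq_zero_iff]
  exact ⟨k, by ring⟩

/-- Multiplication by the cosine shifts the index by `±1`, which gives the stability of the span.
Integer indices keep the recurrence valid at `k = 0`. -/
theorem two_cos_mul_sin (k : ℤ) (t : ℝ) : 2 * Real.cos (2 * t) * Real.sin ((2 * k + 1) * t) =
    Real.sin ((2 * (k + 1 : ℤ) + 1) * t) + Real.sin ((2 * (k - 1 : ℤ) + 1) * t) := by
  have e1 : (2 * ((k + 1 : ℤ) : ℝ) + 1) * t = (2 * k + 1) * t + 2 * t := by push_cast; ring
  have e2 : (2 * ((k - 1 : ℤ) : ℝ) + 1) * t = (2 * k + 1) * t - 2 * t := by push_cast; ring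
  rw [e1, e2, Real.sin_add, Real.sin_sub]
  ring

theorem two_cos_mul_sin_int (n : ℤ) (t : ℝ) : 2 * Real.cos t * Real.sin (n * t) =
    Real.sin ((n + 1 : ℤ) * t) + Real.sin ((n - 1 : ℤ) * t) := by
  have e1 : ((n + 1 : ℤ) : ℝ) * t = n * t + t := by push_cast; ring
  have e2 : ((n - 1 : ℤ) : ℝ) * t = n * t - t := by push_cast; ring
  rw [e1, e2, Real.sin_add, Real.sin_sub]
  ring

end SineIntegrals

/-! ### Sine modes: `c = 0` serves the square, `c = 1` the triangle -/

section SineModes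

/-- The function `sin(αx) sin(βy) - c sin(βx) sin(αy)`. -/
noncomputable def sineMode (c α β : ℝ) (p : ℝ × ℝ) : ℝ :=
  Real.sin (α * p.1) * Real.sin (β * p.2) - c * (Real.sin (β * p.1) * Real.sin (α * p.2))

theorem contDiff_sineMode (c α β : ℝ) : ContDiff ℝ ∞ (sineMode c α β) := by
  unfold sineMode
  fun_prop

theorem pdx_sineMode (c α β : ℝ) : pdx (sineMode c α β) = fun p =>
    α * Real.cos (α * p.1) * Real.sin (β * p.2) -
      c * (β * Real.cos (β * p.1) * Real.sin (α * p.2)) := by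
  funext ⟨x, y⟩
  refine pdx_eq_of_hasDerivAt (contDiff_sineMode c α β) ?_
  have ha : HasDerivAt (fun x => α * x) α x := by simpa using (hasDerivAt_id x).const_mul α
  have hb : HasDerivAt (fun x => β * x) β x := by simpa using (hasDerivAt_id x).const_mul β
  refine ((ha.sin.mul_const (Real.sin (β * y))).sub
    ((hb.sin.mul_const (Real.sin (α * y))).const_mul c)).congr_deriv ?_
  ring

theorem laplacian_sineMode (c α β : ℝ) (p : ℝ × ℝ) :
    pdx (pdx (sineMode c α β)) p + pdy (pdy (sineMode c α β)) p =
      -((α ^ 2 + β ^ 2) * sineMode c α β p) := by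
  obtain ⟨x, y⟩ := p
  have hy1 : pdy (sineMode c α β) = fun p =>
      Real.sin (α * p.1) * (β * Real.cos (β * p.2)) -
        c * (Real.sin (β * p.1) * (α * Real.cos (α * p.2))) := by
    funext ⟨x, y⟩
    refine pdy_eq_of_hasDerivAt (contDiff_sineMode c α β) ?_
    have ha : HasDerivAt (fun x => α * x) α y := by simpa using (hasDerivAt_id y).const_mul α
    have hb : HasDerivAt (fun x => β * x) β y := by simpa using (hasDerivAt_id y).const_mul β
    refine ((hb.sin.const_mul (Real.sin (α * x))).sub
      ((ha.sin.const_mul (Real.sin (β * x))).const_mul c)).congr_deriv ?_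
    ring
  have h1 := pdx_eq_of_hasDerivAt (x := x) (y := y) (contDiff_sineMode c α β).pdx
    (d := -α ^ 2 * (Real.sin (α * x) * Real.sin (β * y)) +
      c * (β ^ 2 * (Real.sin (β * x) * Real.sin (α * y)))) (by
      rw [pdx_sineMode]
      have ha : HasDerivAt (fun x => α * x) α x := by simpa using (hasDerivAt_id x).const_mul α
      have hb : HasDerivAt (fun x => β * x) β x := by simpa using (hasDerivAt_id x).const_mul β
      refine (((ha.cos.const_mul α).mul_const (Real.sin (β * y))).sub
        (((hb.cos.const_mul β).mul_const (Real.sin (α * y))).const_mul c)).congr_deriv ?_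
      ring)
  have h2 := pdy_eq_of_hasDerivAt (x := x) (y := y) (contDiff_sineMode c α β).pdy
    (d := -β ^ 2 * (Real.sin (α * x) * Real.sin (β * y)) +
      c * (α ^ 2 * (Real.sin (β * x) * Real.sin (α * y)))) (by
      rw [hy1]
      have ha : HasDerivAt (fun x => α * x) α y := by simpa using (hasDerivAt_id y).const_mul α
      have hb : HasDerivAt (fun x => β * x) β y := by simpa using (hasDerivAt_id y).const_mul β
      refine (((hb.cos.const_mul β).const_mul (Real.sin (α * x))).sub
        (((ha.cos.const_mul α).const_mul (Real.sin (β * x))).const_mul c)).congr_deriv ?_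
      ring)
  rw [h1, h2, sineMode]
  ring

end SineModes

/-! ### The square -/

section Square

theorem isBounded_squareΩ : Bornology.IsBounded squareΩ :=
  (Metric.isBounded_Ioo 0 1).prod (Metric.isBounded_Ioo 0 1)

theorem isOpen_squareΩ : IsOpen squareΩ := isOpen_Ioo.prod isOpen_Ioo

/-- The eigenfunctions of the square, `sin((2m+1)πx/2) sin(nπy)`. -/
noncomputable def squareMode (m n : ℤ) : ℝ × ℝ → ℝ :=
  sineMode 0 ((2 * m + 1) * (Real.pi / 2)) (n * Real.pi)

theorem squareMode_apply (m n : ℤ) (p : ℝ × ℝ) : squareMode m n p =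
    Real.sin ((2 * m + 1) * (Real.pi / 2) * p.1) * Real.sin (n * Real.pi * p.2) := by
  simp [squareMode, sineMode]

theorem continuous_squareMode (m n : ℤ) : Continuous (squareMode m n) :=
  (contDiff_sineMode _ _ _).continuous

theorem squareMode_mem_mixedLaplacian (i : SquareIndex) :
    (toL2 isBounded_squareΩ (squareMode i.1.1 i.1.2) (continuous_squareMode _ _),
      (squareEV i : ℂ) •
        toL2 isBounded_squareΩ (squareMode i.1.1 i.1.2) (continuous_squareMode _ _)) ∈
      mixedLaplacian squareΩ squareD := by
  refine mem_mixedLaplacian_of_slices isBounded_squareΩ isOpen_squareΩ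
    (contDiff_sineMode _ _ _) ?_ ?_ ?_ ?_
  · rintro ⟨x, y⟩ (⟨hx, -⟩ | ⟨-, hy⟩)
    · have hx : x = 0 := hx
      simp [sineMode, hx]
    · rcases hy with hy | hy
      · have hy : y = 0 := hy
        simp [sineMode, hy]
      · have hy : y = 1 := hy
        simp [sineMode, hy]
  · intro p
    rw [laplacian_sineMode, squareEV]
    push_cast
    ring
  · intro y
    by_cases hy : y ∈ Set.Ioo (0 : ℝ) 1
    · refine Or.inr ⟨0, 1, zero_le_one, ?_, Or.inl (subset_closure (Or.inl ⟨rfl, hy.1.le, hy.2.le⟩)),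
        Or.inr ?_⟩
      · ext x
        exact ⟨fun h => h.1, fun h => ⟨h, hy⟩⟩
      · rw [pdx_sineMode]
        simp only [mul_one, cos_odd_mul_pi_div_two]
        ring
    · exact Or.inl fun x h => hy h.2
  · intro x
    by_cases hx : x ∈ Set.Ioo (0 : ℝ) 1
    · refine Or.inr ⟨0, 1, zero_le_one, ?_, Or.inl (subset_closure (Or.inr ⟨hx, Or.inl rfl⟩)),
        Or.inl (subset_closure (Or.inr ⟨hx, Or.inr rfl⟩))⟩
      ext y
      exact ⟨fun h => h.2, fun h => ⟨hx, h⟩⟩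
    · exact Or.inl fun y h => hx h.1

theorem odd_mul_sq_ne {k l : ℕ} {a : ℝ} (ha : a ≠ 0) (h : k ≠ l) :
    ((2 * ((k : ℤ) : ℝ) + 1) * a) ^ 2 ≠ ((2 * ((l : ℤ) : ℝ) + 1) * a) ^ 2 := by
  intro he
  rw [mul_pow, mul_pow] at he
  have h1 := mul_right_cancel₀ (pow_ne_zero 2 ha) he
  rw [sq_eq_sq₀ (by positivity) (by positivity)] at h1
  apply h
  push_cast at h1
  exact_mod_cast (by linarith : (k : ℝ) = l)

theorem inner_squareMode (m n m' n' : ℤ) :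
    inner ℂ (toL2 isBounded_squareΩ (squareMode m n) (continuous_squareMode _ _))
      (toL2 isBounded_squareΩ (squareMode m' n') (continuous_squareMode _ _)) =
    (((∫ x in (0 : ℝ)..1, Real.sin ((2 * m + 1) * (Real.pi / 2) * x) *
      Real.sin ((2 * m' + 1) * (Real.pi / 2) * x)) *
      ∫ y in (0 : ℝ)..1, Real.sin (n * Real.pi * y) * Real.sin (n' * Real.pi * y) : ℝ) : ℂ) := by
  rw [inner_toL2_toL2, ← setIntegral_Ioo_prod_mul zero_le_one]
  congr 1
  refine integral_congr_ae (ae_of_all _ fun p => ?_)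
  simp only [squareMode_apply]
  ring

/-- The reflections `n ↦ -n` and `m ↦ -m - 1` only change the sign of a mode, and `n = 0` gives
zero. So orthogonality extends to all integer indices, where the cosine recurrences never leave the
family. The multipliers `2cos(πx)` and `2cos(πy)` are injective on `[0, 1]`, and the mode `(0, 1)`
is positive inside. -/
theorem squareMode_complete (f : L2 squareΩ)
    (hf : ∀ i : SquareIndex, inner ℂ (toL2 isBounded_squareΩ (squareMode i.1.1 i.1.2)
      (continuous_squareMode _ _)) f = 0) : f = 0 := by
  have hf' : ∀ m n : ℕ, ∫ p in squareΩ, squareMode m n p • f p = 0 := fun m n => by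
    rcases Nat.eq_zero_or_pos n with rfl | hn
    · simp [squareMode_apply]
    · rw [← inner_toL2_left isBounded_squareΩ (continuous_squareMode _ _)]
      exact hf ⟨(m, n), hn⟩
  have hn : ∀ m : ℕ, ∀ n : ℤ, ∫ p in squareΩ, squareMode m n p • f p = 0 := fun m n => by
    rcases Int.eq_nat_or_neg n with ⟨k, rfl | rfl⟩
    · exact hf' m k
    · rw [← neg_eq_zero, ← integral_neg, ← hf' m k]
      simp [squareMode_apply]
  have hm : ∀ i : ℤ × ℤ, ∫ p in squareΩ, squareMode i.1 i.2 p • f p = 0 := by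
    rintro ⟨m, n⟩
    rcases le_or_gt 0 m with h | h
    · lift m to ℕ using h
      exact hn m n
    · have h1 := hn (-m - 1).toNat n
      rw [Int.toNat_of_nonneg (by omega)] at h1
      rw [← neg_eq_zero, ← integral_neg, ← h1]
      refine integral_congr_ae (ae_of_all _ fun p => ?_)
      simp only [squareMode_apply, ← neg_smul]
      congr 1
      have : (2 * ((-m - 1 : ℤ) : ℝ) + 1) * (Real.pi / 2) * p.1 =
        -((2 * m + 1) * (Real.pi / 2) * p.1) := by push_cast; ring
      rw [this, Real.sin_neg]
      ring
  have hmem : ∀ m n : ℤ, squareMode m n ∈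
      Submodule.span ℝ (Set.range fun i : ℤ × ℤ => squareMode i.1 i.2) :=
    fun m n => Submodule.subset_span ⟨(m, n), rfl⟩
  refine eq_zero_of_orthogonal_span isBounded_squareΩ isOpen_squareΩ
    (g := fun i : ℤ × ℤ => squareMode i.1 i.2) (fun i => continuous_squareMode _ _)
    (P := fun p => 2 * Real.cos (2 * (Real.pi / 2 * p.1)))
    (Q := fun p => 2 * Real.cos (Real.pi * p.2)) (by fun_prop) (by fun_prop) ?_ ?_ ?_ (0, 1) ?_ hm
  · have hcl : closure squareΩ ⊆ Set.Icc 0 1 ×ˢ Set.Icc 0 1 :=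
      closure_minimal (Set.prod_mono Set.Ioo_subset_Icc_self Set.Ioo_subset_Icc_self)
        (isClosed_Icc.prod isClosed_Icc)
    have hpi : ∀ {t : ℝ}, t ∈ Set.Icc (0 : ℝ) 1 → Real.pi * t ∈ Set.Icc 0 Real.pi := fun ht =>
      ⟨mul_nonneg Real.pi_pos.le ht.1, mul_le_of_le_one_right Real.pi_pos.le ht.2⟩
    have hinj : ∀ {s t : ℝ}, s ∈ Set.Icc (0 : ℝ) 1 → t ∈ Set.Icc (0 : ℝ) 1 →
        Real.cos (Real.pi * s) = Real.cos (Real.pi * t) → s = t := fun hs ht h =>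
      mul_left_cancel₀ Real.pi_ne_zero (Real.injOn_cos (hpi hs) (hpi ht) h)
    intro p hp q hq h
    have hp' := hcl hp
    have hq' := hcl hq
    simp only [Prod.mk.injEq] at h
    have e : ∀ t : ℝ, 2 * (Real.pi / 2 * t) = Real.pi * t := fun t => by ring
    rw [e, e] at h
    exact Prod.ext (hinj hp'.1 hq'.1 (by linarith)) (hinj hp'.2 hq'.2 (by linarith))
  · rintro ⟨m, n⟩
    convert Submodule.add_mem _ (hmem (m + 1) n) (hmem (m - 1) n) using 1
    funext p
    have := two_cos_mul_sin m (Real.pi / 2 * p.1)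
    simp only [Pi.mul_apply, Pi.add_apply, squareMode_apply, mul_assoc] at this ⊢
    linear_combination Real.sin (n * (Real.pi * p.2)) * this
  · rintro ⟨m, n⟩
    convert Submodule.add_mem _ (hmem m (n + 1)) (hmem m (n - 1)) using 1
    funext p
    have := two_cos_mul_sin_int n (Real.pi * p.2)
    simp only [Pi.mul_apply, Pi.add_apply, squareMode_apply, mul_assoc] at this ⊢
    linear_combination Real.sin ((2 * m + 1) * (Real.pi / 2 * p.1)) * this
  · rintro ⟨x, y⟩ ⟨hx, hy⟩
    simp only [Set.mem_Ioo] at hx hy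
    simp only [squareMode_apply]
    have h1 : 0 < Real.sin (Real.pi / 2 * x) :=
      Real.sin_pos_of_pos_of_lt_pi (by nlinarith [Real.pi_pos]) (by nlinarith [Real.pi_pos])
    have h2 : 0 < Real.sin (Real.pi * y) :=
      Real.sin_pos_of_pos_of_lt_pi (by nlinarith [Real.pi_pos]) (by nlinarith [Real.pi_pos])
    simpa using ⟨h1.ne', h2.ne'⟩

theorem spectrumIs_square : SpectrumIs squareΩ squareD squareEV := by
  have hpi : (Real.pi / 2) ≠ 0 := by positivity
  refine spectrumIs_of_orthogonal (e := fun i => toL2 isBounded_squareΩ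
    (squareMode i.1.1 i.1.2) (continuous_squareMode _ _)) ?_ ?_ squareMode_complete
    squareMode_mem_mixedLaplacian (finite_setOf_le ?_ ?_)
  · rintro ⟨⟨m, n⟩, hn⟩ h0
    have h := inner_squareMode m n m n
    simp only at h0 h hn
    rw [h0, inner_zero_left, integral_sin_mul_self, integral_sin_mul_self] at h
    · norm_num at h
    · exact mul_ne_zero (by exact_mod_cast (by omega : n ≠ 0)) Real.pi_ne_zero
    · simp
    · have : (2 * (m : ℝ) + 1) ≠ 0 := by positivity
      simpa using this
    · rw [mul_one, cos_odd_mul_pi_div_two, mul_zero]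
  · rintro ⟨⟨m, n⟩, hn⟩ ⟨⟨m', n'⟩, hn'⟩ hne
    change inner ℂ (toL2 _ (squareMode m n) _) (toL2 _ (squareMode m' n') _) = 0
    rw [inner_squareMode]
    by_cases hm : m = m'
    · have hnn : n ≠ n' := by rintro rfl; exact hne (by simp [hm])
      rw [integral_sin_mul_sin_eq_zero (α := (n : ℤ) * Real.pi), mul_zero, Complex.ofReal_zero]
      · intro he
        rw [mul_pow, mul_pow] at he
        have h1 := mul_right_cancel₀ (pow_ne_zero 2 Real.pi_ne_zero) he
        rw [sq_eq_sq₀ (by positivity) (by positivity)] at h1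
        exact hnn (by exact_mod_cast h1)
      · simp
    · rw [integral_sin_mul_sin_eq_zero (odd_mul_sq_ne hpi hm), zero_mul, Complex.ofReal_zero]
      simp only [mul_one, cos_odd_mul_pi_div_two]
      ring
  all_goals
    rintro ⟨⟨m, n⟩, hn⟩
    have h1 : 1 ≤ Real.pi ^ 2 / 4 := by nlinarith [Real.pi_gt_three]
    have hm0 : (0 : ℝ) ≤ m := m.cast_nonneg
    have hn1 : (1 : ℝ) ≤ n := by exact_mod_cast hn
    refine le_trans ?_ (le_mul_of_one_le_left (by positivity) h1)
    simp only
    nlinarith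

end Square

/-! ### The triangle -/

section Triangle

theorem triangleΩ_subset : triangleΩ ⊆ Set.Ioo 0 (√2) ×ˢ Set.Ioo 0 (√2) := fun _ h =>
  ⟨⟨h.1, h.2.1⟩, ⟨h.2.2.1, h.2.2.2.trans h.2.1⟩⟩

theorem isBounded_triangleΩ : Bornology.IsBounded triangleΩ :=
  ((Metric.isBounded_Ioo 0 _).prod (Metric.isBounded_Ioo 0 _)).subset triangleΩ_subset

theorem isOpen_triangleΩ : IsOpen triangleΩ :=
  (isOpen_lt continuous_const continuous_fst).inter
    ((isOpen_lt continuous_fst continuous_const).inter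
      ((isOpen_lt continuous_const continuous_snd).inter
        (isOpen_lt continuous_snd continuous_fst)))

/-- The lowest frequency on a leg of the triangle. -/
noncomputable def legFreq : ℝ := Real.pi / (2 * √2)

theorem legFreq_pos : 0 < legFreq := by
  have := Real.pi_pos
  unfold legFreq
  positivity

theorem legFreq_mul : legFreq * √2 = Real.pi / 2 := by
  have : √2 ≠ 0 := by positivity
  unfold legFreq
  field_simp

theorem legFreq_sq : legFreq ^ 2 = Real.pi ^ 2 / 8 := by
  rw [legFreq, div_pow, mul_pow, Real.sq_sqrt (by norm_num)]
  norm_num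

theorem odd_mul_legFreq_mul (k : ℤ) :
    (2 * k + 1) * legFreq * √2 = (2 * k + 1) * (Real.pi / 2) := by
  rw [mul_assoc, legFreq_mul]

/-- The eigenfunctions of the triangle. -/
noncomputable def triangleMode (k l : ℤ) : ℝ × ℝ → ℝ :=
  sineMode 1 ((2 * k + 1) * legFreq) ((2 * l + 1) * legFreq)

theorem triangleMode_apply (k l : ℤ) (p : ℝ × ℝ) : triangleMode k l p =
    Real.sin ((2 * k + 1) * legFreq * p.1) * Real.sin ((2 * l + 1) * legFreq * p.2) -
      Real.sin ((2 * l + 1) * legFreq * p.1) * Real.sin ((2 * k + 1) * legFreq * p.2) := by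
  simp [triangleMode, sineMode]

theorem continuous_triangleMode (k l : ℤ) : Continuous (triangleMode k l) :=
  (contDiff_sineMode _ _ _).continuous

theorem triangleMode_swap (k l : ℤ) (p : ℝ × ℝ) :
    triangleMode k l p.swap = -triangleMode k l p := by
  simp only [triangleMode_apply, Prod.fst_swap, Prod.snd_swap]
  ring

theorem triangleMode_comm (k l : ℤ) (p : ℝ × ℝ) :
    triangleMode l k p = -triangleMode k l p := by
  simp only [triangleMode_apply]
  ring

theorem triangleMode_mem_mixedLaplacian (i : TriangleIndex) :
    (toL2 isBounded_triangleΩ (triangleMode i.1.1 i.1.2) (continuous_triangleMode _ _),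
      (triangleEV i : ℂ) •
        toL2 isBounded_triangleΩ (triangleMode i.1.1 i.1.2) (continuous_triangleMode _ _)) ∈
      mixedLaplacian triangleΩ triangleD := by
  refine mem_mixedLaplacian_of_slices isBounded_triangleΩ isOpen_triangleΩ
    (contDiff_sineMode _ _ _) ?_ ?_ ?_ ?_
  · rintro ⟨x, y⟩ (⟨-, hy⟩ | ⟨-, hy⟩)
    · have hy : y = 0 := hy
      simp [sineMode, hy]
    · have hy : y = x := hy
      simp only [sineMode, hy]
      ring
  · intro p
    rw [laplacian_sineMode, triangleEV, ← legFreq_sq]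
    push_cast
    ring
  · intro y
    by_cases hy : y ∈ Set.Ioo (0 : ℝ) (√2)
    -- A horizontal slice runs from the hypotenuse to the Neumann leg; the vertical ones below have
    -- both ends on Dirichlet sides.
    · refine Or.inr ⟨y, √2, hy.2.le, ?_, Or.inl (subset_closure (Or.inr ⟨hy, rfl⟩)), Or.inr ?_⟩
      · ext x
        exact ⟨fun h => ⟨h.2.2.2, h.2.1⟩, fun h => ⟨hy.1.trans h.1, h.2, hy.1, h.1⟩⟩
      · rw [pdx_sineMode]
        simp only [odd_mul_legFreq_mul, cos_odd_mul_pi_div_two]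
        ring
    · exact Or.inl fun x h => hy (triangleΩ_subset h).2
  · intro x
    by_cases hx : x ∈ Set.Ioo (0 : ℝ) (√2)
    · refine Or.inr ⟨0, x, hx.1.le, ?_, Or.inl (subset_closure (Or.inl ⟨hx, rfl⟩)),
        Or.inl (subset_closure (Or.inr ⟨hx, rfl⟩))⟩
      ext y
      exact ⟨fun h => h.2.2, fun h => ⟨hx.1, hx.2, h⟩⟩
    · exact Or.inl fun y h => hx (triangleΩ_subset h).1

theorem volume_diagonal : volume {p : ℝ × ℝ | p.1 = p.2} = 0 := by
  have hm : MeasurableSet {p : ℝ × ℝ | p.1 = p.2} :=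
    measurableSet_eq_fun measurable_fst measurable_snd
  rw [Measure.volume_eq_prod, Measure.prod_apply hm]
  refine (lintegral_congr fun x => ?_).trans lintegral_zero
  have : Prod.mk x ⁻¹' {p : ℝ × ℝ | p.1 = p.2} = {x} := by
    ext y
    exact eq_comm
  rw [this, Real.volume_singleton]

/-- The integral over the square of a function symmetric in the diagonal is twice its integral over
the triangle. -/
theorem setIntegral_square_eq_two_mul_triangle {F : ℝ × ℝ → ℝ} (hF : Continuous F)
    (hswap : ∀ p, F p.swap = F p) :
    ∫ p in Set.Ioo 0 (√2) ×ˢ Set.Ioo 0 (√2), F p = 2 * ∫ p in triangleΩ, F p := by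
  have hmp : MeasurePreserving (Prod.swap : ℝ × ℝ → ℝ × ℝ) volume volume :=
    Measure.measurePreserving_swap
  have hb' : Bornology.IsBounded (Prod.swap ⁻¹' triangleΩ) :=
    ((Metric.isBounded_Ioo 0 (√2)).prod (Metric.isBounded_Ioo 0 (√2))).subset fun p hp =>
      (triangleΩ_subset hp).symm
  have hm' : MeasurableSet (Prod.swap ⁻¹' triangleΩ) :=
    measurable_swap isOpen_triangleΩ.measurableSet
  have hdis : Disjoint triangleΩ (Prod.swap ⁻¹' triangleΩ) := Set.disjoint_left.2 fun p hp hp' =>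
    lt_asymm (hp.2.2.2 : p.2 < p.1) (hp'.2.2.2 : p.1 < p.2)
  have hae : (Set.Ioo 0 (√2) ×ˢ Set.Ioo 0 (√2) : Set (ℝ × ℝ)) =ᵐ[volume]
      (triangleΩ ∪ Prod.swap ⁻¹' triangleΩ : Set (ℝ × ℝ)) := by
    filter_upwards [measure_eq_zero_iff_ae_notMem.1 volume_diagonal] with p hp
    refine propext ⟨fun h => ?_, fun h => ?_⟩
    · have h : p ∈ Set.Ioo 0 (√2) ×ˢ Set.Ioo 0 (√2) := h
      rcases lt_or_gt_of_ne (show p.1 ≠ p.2 from hp) with hlt | hlt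
      · exact Or.inr ⟨h.2.1, h.2.2, h.1.1, hlt⟩
      · exact Or.inl ⟨h.1.1, h.1.2, h.2.1, hlt⟩
    · rcases h with h | h
      · exact triangleΩ_subset h
      · exact (triangleΩ_subset h).symm
  rw [setIntegral_congr_set hae, setIntegral_union hdis hm'
    (integrableOn_of_isBounded isBounded_triangleΩ hF) (integrableOn_of_isBounded hb' hF)]
  have := hmp.setIntegral_preimage_emb MeasurableEquiv.prodComm.measurableEmbedding F triangleΩ
  simp only [hswap] at this
  rw [this]
  ring

/-- The `L²(0,√2)` inner product of two sines with the frequencies occurring on the legs. -/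
noncomputable def legInner (k l : ℤ) : ℝ :=
  ∫ x in (0 : ℝ)..√2, Real.sin ((2 * k + 1) * legFreq * x) * Real.sin ((2 * l + 1) * legFreq * x)

theorem legInner_of_ne {k l : ℕ} (h : k ≠ l) : legInner k l = 0 := by
  refine integral_sin_mul_sin_eq_zero (odd_mul_sq_ne legFreq_pos.ne' h) ?_
  simp only [odd_mul_legFreq_mul, cos_odd_mul_pi_div_two]
  ring

theorem legInner_self (k : ℕ) : legInner k k = √2 / 2 := by
  refine integral_sin_mul_self ?_ ?_
  · have := legFreq_pos
    push_cast
    positivity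
  · rw [odd_mul_legFreq_mul, cos_odd_mul_pi_div_two, mul_zero]

/-- A product of two modes is symmetric in the diagonal, so its integral over the triangle is half
of that over the square. There it splits into four separated terms, equal in pairs, leaving a 2×2
determinant. -/
theorem inner_triangleMode (k l k' l' : ℤ) :
    inner ℂ (toL2 isBounded_triangleΩ (triangleMode k l) (continuous_triangleMode _ _))
      (toL2 isBounded_triangleΩ (triangleMode k' l') (continuous_triangleMode _ _)) =
    ((legInner k k' * legInner l l' - legInner k l' * legInner l k' : ℝ) : ℂ) := by
  have hsq : (0 : ℝ) ≤ √2 := Real.sqrt_nonneg 2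
  have h := setIntegral_square_eq_two_mul_triangle
    ((continuous_triangleMode k l).mul (continuous_triangleMode k' l'))
    (fun p => by simp only [Pi.mul_apply, triangleMode_swap]; ring)
  let s : ℤ → ℝ → ℝ := fun k x => Real.sin ((2 * k + 1) * legFreq * x)
  have hs : ∀ k, Continuous (s k) := fun k => by fun_prop
  have hi : ∀ a b c d, IntegrableOn (fun p : ℝ × ℝ => (s a p.1 * s b p.1) * (s c p.2 * s d p.2))
      (Set.Ioo 0 (√2) ×ˢ Set.Ioo 0 (√2)) := fun a b c d =>
    integrableOn_of_isBounded ((Metric.isBounded_Ioo 0 (√2)).prod (Metric.isBounded_Ioo 0 (√2)))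
      (((((hs a).mul (hs b)).comp continuous_fst)).mul ((((hs c).mul (hs d)).comp continuous_snd)))
  have hi' : ∀ a b c d a' b' c' d', IntegrableOn (fun p : ℝ × ℝ =>
      (s a p.1 * s b p.1) * (s c p.2 * s d p.2) + (s a' p.1 * s b' p.1) * (s c' p.2 * s d' p.2))
      (Set.Ioo 0 (√2) ×ˢ Set.Ioo 0 (√2)) := fun a b c d a' b' c' d' =>
    (hi a b c d).add (hi a' b' c' d')
  have hJ : ∀ a b c d, ∫ p in Set.Ioo 0 (√2) ×ˢ Set.Ioo 0 (√2),
      (s a p.1 * s b p.1) * (s c p.2 * s d p.2) = legInner a b * legInner c d := fun a b c d =>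
    setIntegral_Ioo_prod_mul hsq (fun x => s a x * s b x) (fun y => s c y * s d y)
  have hexp : ∀ p : ℝ × ℝ, triangleMode k l p * triangleMode k' l' p =
      (s k p.1 * s k' p.1) * (s l p.2 * s l' p.2) + (s l p.1 * s l' p.1) * (s k p.2 * s k' p.2) -
      ((s k p.1 * s l' p.1) * (s l p.2 * s k' p.2) +
        (s l p.1 * s k' p.1) * (s k p.2 * s l' p.2)) := fun p => by
    simp only [triangleMode_apply, s]
    ring
  simp only [Pi.mul_apply, hexp] at h
  rw [integral_sub (hi' _ _ _ _ _ _ _ _) (hi' _ _ _ _ _ _ _ _),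
    integral_add (hi _ _ _ _) (hi _ _ _ _), integral_add (hi _ _ _ _) (hi _ _ _ _),
    hJ, hJ, hJ, hJ] at h
  rw [inner_toL2_toL2]
  simp only [hexp]
  congr 1
  linarith

/-- Sum and product determine the two roots of a quadratic, and the ordering tells them apart. -/
theorem eq_and_eq_of_add_eq_of_mul_eq {a b c d : ℝ} (hab : a ≤ b) (hcd : c ≤ d)
    (hs : a + b = c + d) (hp : a * b = c * d) : a = c ∧ b = d := by
  have h : (a - c) * (a - d) = 0 := by linear_combination a * hs - hp
  rcases mul_eq_zero.1 h with h | h <;> constructor <;> linarith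

/-- Multiplication by one cosine would destroy antisymmetry, so the multipliers are the elementary
symmetric functions of the two cosines. They separate points because the cosines are ordered on the
triangle. Orthogonality extends to integer indices since exchanging `k` and `l`, or replacing `k` by
`-k - 1`, changes the sign, and `k = l` gives zero. -/
theorem triangleMode_complete (f : L2 triangleΩ)
    (hf : ∀ i : TriangleIndex, inner ℂ (toL2 isBounded_triangleΩ (triangleMode i.1.1 i.1.2)
      (continuous_triangleMode _ _)) f = 0) : f = 0 := by
  have hlt : ∀ k l : ℕ, l < k → ∫ p in triangleΩ, triangleMode k l p • f p = 0 := fun k l h => by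
    rw [← inner_toL2_left isBounded_triangleΩ (continuous_triangleMode _ _)]
    exact hf ⟨(k, l), h⟩
  have hnat : ∀ k l : ℕ, ∫ p in triangleΩ, triangleMode k l p • f p = 0 := fun k l => by
    rcases lt_trichotomy l k with h | rfl | h
    · exact hlt k l h
    · simp [triangleMode_apply]
    · rw [← neg_eq_zero, ← integral_neg, ← hlt l k h]
      simp only [triangleMode_comm k l, neg_smul]
  have hsin : ∀ (k : ℤ) (t : ℝ), Real.sin ((2 * ((-k - 1 : ℤ) : ℝ) + 1) * legFreq * t) =
      -Real.sin ((2 * k + 1) * legFreq * t) := fun k t => by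
    rw [← Real.sin_neg]
    congr 1
    push_cast
    ring
  have hrefl : ∀ k l : ℤ, ∀ p, triangleMode (-k - 1) l p = -triangleMode k l p := fun k l p => by
    simp only [triangleMode_apply, hsin]
    ring
  have hl : ∀ (k : ℤ) (l : ℕ), ∫ p in triangleΩ, triangleMode k l p • f p = 0 := fun k l => by
    rcases le_or_gt 0 k with h | h
    · lift k to ℕ using h
      exact hnat k l
    · have h1 := hnat (-k - 1).toNat l
      rw [Int.toNat_of_nonneg (by omega)] at h1
      rw [← neg_eq_zero, ← integral_neg, ← h1]
      simp only [hrefl, neg_smul]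
  have hk : ∀ i : ℤ × ℤ, ∫ p in triangleΩ, triangleMode i.1 i.2 p • f p = 0 := by
    rintro ⟨k, l⟩
    rcases le_or_gt 0 l with h | h
    · lift l to ℕ using h
      exact hl k l
    · have h1 := hl k (-l - 1).toNat
      rw [Int.toNat_of_nonneg (by omega)] at h1
      rw [← neg_eq_zero, ← integral_neg, ← h1]
      simp only [triangleMode_comm _ k, hrefl, neg_smul, neg_neg]
  have hmem : ∀ k l : ℤ, triangleMode k l ∈
      Submodule.span ℝ (Set.range fun i : ℤ × ℤ => triangleMode i.1 i.2) :=
    fun k l => Submodule.subset_span ⟨(k, l), rfl⟩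
  have hrec : ∀ (k : ℤ) (t : ℝ),
      2 * Real.cos (2 * (legFreq * t)) * Real.sin ((2 * k + 1) * legFreq * t) =
      Real.sin ((2 * (k + 1 : ℤ) + 1) * legFreq * t) +
        Real.sin ((2 * (k - 1 : ℤ) + 1) * legFreq * t) := fun k t => by
    have := two_cos_mul_sin k (legFreq * t)
    simpa only [mul_assoc] using this
  refine eq_zero_of_orthogonal_span isBounded_triangleΩ isOpen_triangleΩ
    (g := fun i : ℤ × ℤ => triangleMode i.1 i.2) (fun i => continuous_triangleMode _ _)
    (P := fun p => 2 * Real.cos (2 * (legFreq * p.1)) + 2 * Real.cos (2 * (legFreq * p.2)))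
    (Q := fun p => 2 * Real.cos (2 * (legFreq * p.1)) * (2 * Real.cos (2 * (legFreq * p.2))))
    (by fun_prop) (by fun_prop) ?_ ?_ ?_ (1, 0) ?_ hk
  · have hcl : closure triangleΩ ⊆ {p | (0 ≤ p.2 ∧ p.2 ≤ p.1) ∧ p.1 ≤ √2} :=
      closure_minimal (fun p hp => ⟨⟨hp.2.2.1.le, hp.2.2.2.le⟩, hp.2.1.le⟩)
        (((isClosed_le continuous_const continuous_snd).inter
          (isClosed_le continuous_snd continuous_fst)).inter
            (isClosed_le continuous_fst continuous_const))
    have hpi : ∀ {t : ℝ}, 0 ≤ t → t ≤ √2 → 2 * (legFreq * t) ∈ Set.Icc 0 Real.pi :=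
      fun {t} h0 h1 => by
      have h2 := mul_le_mul_of_nonneg_left h1 legFreq_pos.le
      rw [legFreq_mul] at h2
      have h3 := mul_nonneg legFreq_pos.le h0
      exact ⟨by linarith, by linarith⟩
    have hinj : ∀ {s t : ℝ}, 0 ≤ s → s ≤ √2 → 0 ≤ t → t ≤ √2 →
        Real.cos (2 * (legFreq * s)) = Real.cos (2 * (legFreq * t)) → s = t :=
      fun h1 h2 h3 h4 h => by
      have := Real.injOn_cos (hpi h1 h2) (hpi h3 h4) h
      exact mul_left_cancel₀ legFreq_pos.ne' (by linarith)
    have hle : ∀ p ∈ closure triangleΩ,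
        2 * Real.cos (2 * (legFreq * p.1)) ≤ 2 * Real.cos (2 * (legFreq * p.2)) := fun p hp => by
      obtain ⟨⟨h0, h1⟩, h2⟩ := hcl hp
      have h3 := mul_le_mul_of_nonneg_left h1 legFreq_pos.le
      have := Real.cos_le_cos_of_nonneg_of_le_pi (hpi h0 (h1.trans h2)).1
        (hpi (h0.trans h1) h2).2 (by linarith)
      linarith
    intro p hp q hq h
    obtain ⟨⟨hp0, hp1⟩, hp2⟩ := hcl hp
    obtain ⟨⟨hq0, hq1⟩, hq2⟩ := hcl hq
    simp only [Prod.mk.injEq] at h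
    obtain ⟨e1, e2⟩ := eq_and_eq_of_add_eq_of_mul_eq (hle p hp) (hle q hq) h.1 h.2
    exact Prod.ext (hinj (hp0.trans hp1) hp2 (hq0.trans hq1) hq2 (by linarith))
      (hinj hp0 (hp1.trans hp2) hq0 (hq1.trans hq2) (by linarith))
  · rintro ⟨k, l⟩
    convert Submodule.add_mem _ (Submodule.add_mem _ (hmem (k + 1) l) (hmem (k - 1) l))
      (Submodule.add_mem _ (hmem k (l + 1)) (hmem k (l - 1))) using 1
    funext p
    simp only [Pi.mul_apply, Pi.add_apply, triangleMode_apply]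
    linear_combination Real.sin ((2 * l + 1) * legFreq * p.2) * hrec k p.1 +
      Real.sin ((2 * k + 1) * legFreq * p.1) * hrec l p.2 -
      Real.sin ((2 * k + 1) * legFreq * p.2) * hrec l p.1 -
      Real.sin ((2 * l + 1) * legFreq * p.1) * hrec k p.2
  · rintro ⟨k, l⟩
    convert Submodule.add_mem _
      (Submodule.add_mem _ (hmem (k + 1) (l + 1)) (hmem (k + 1) (l - 1)))
      (Submodule.add_mem _ (hmem (k - 1) (l + 1)) (hmem (k - 1) (l - 1))) using 1
    funext p
    simp only [Pi.mul_apply, Pi.add_apply, triangleMode_apply]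
    linear_combination
      2 * Real.cos (2 * (legFreq * p.2)) * Real.sin ((2 * l + 1) * legFreq * p.2) * hrec k p.1 +
      (Real.sin ((2 * (k + 1 : ℤ) + 1) * legFreq * p.1) +
        Real.sin ((2 * (k - 1 : ℤ) + 1) * legFreq * p.1)) * hrec l p.2 -
      2 * Real.cos (2 * (legFreq * p.2)) * Real.sin ((2 * k + 1) * legFreq * p.2) * hrec l p.1 -
      (Real.sin ((2 * (l + 1 : ℤ) + 1) * legFreq * p.1) +
        Real.sin ((2 * (l - 1 : ℤ) + 1) * legFreq * p.1)) * hrec k p.2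
  · rintro ⟨x, y⟩ ⟨-, hx, hy, hyx⟩
    simp only at hx hy hyx
    have h0 := mul_pos legFreq_pos hy
    have h1 := mul_lt_mul_of_pos_left hyx legFreq_pos
    have h2 := mul_lt_mul_of_pos_left hx legFreq_pos
    rw [legFreq_mul] at h2
    have s0 : 0 < Real.sin (legFreq * y) := Real.sin_pos_of_pos_of_lt_pi h0 (by linarith)
    have s1 : Real.sin (legFreq * y) < Real.sin (legFreq * x) :=
      Real.sin_lt_sin_of_lt_of_le_pi_div_two (by linarith) h2.le h1
    have e3 : ∀ t : ℝ, (2 * ((1 : ℤ) : ℝ) + 1) * legFreq * t = 3 * (legFreq * t) := fun t => by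
      push_cast
      ring
    have e1 : ∀ t : ℝ, (2 * ((0 : ℤ) : ℝ) + 1) * legFreq * t = legFreq * t := fun t => by
      push_cast
      ring
    simp only [triangleMode_apply, e3, e1, Real.sin_three_mul]
    -- The triple angle formula turns the mode `(1, 0)` into minus this product, in which `0 <
    -- sin(ωy) < sin(ωx)` with `ω = legFreq`.
    have : 0 < 4 * Real.sin (legFreq * x) * Real.sin (legFreq * y) *
        ((Real.sin (legFreq * x) - Real.sin (legFreq * y)) *
          (Real.sin (legFreq * x) + Real.sin (legFreq * y))) := by
      have := s0.trans s1
      have := sub_pos.2 s1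
      positivity
    refine ne_of_lt ?_
    linarith

theorem spectrumIs_triangle : SpectrumIs triangleΩ triangleD triangleEV := by
  refine spectrumIs_of_orthogonal (e := fun i => toL2 isBounded_triangleΩ
    (triangleMode i.1.1 i.1.2) (continuous_triangleMode _ _)) ?_ ?_ triangleMode_complete
    triangleMode_mem_mixedLaplacian (finite_setOf_le ?_ ?_)
  · rintro ⟨⟨k, l⟩, hkl⟩ h0
    have h := inner_triangleMode k l k l
    simp only at h0 h hkl
    rw [h0, inner_zero_left, legInner_self, legInner_self, legInner_of_ne hkl.ne'] at h
    norm_num at h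
  · rintro ⟨⟨k, l⟩, hkl⟩ ⟨⟨k', l'⟩, hkl'⟩ hne
    change inner ℂ (toL2 _ (triangleMode k l) _) (toL2 _ (triangleMode k' l') _) = 0
    simp only at hkl hkl'
    have h1 : legInner k k' * legInner l l' = 0 := by
      by_cases hk : k = k'
      · rw [legInner_of_ne (k := l) (l := l') (by rintro rfl; exact hne (by simp [hk])), mul_zero]
      -- The crossed term below also vanishes: `k = l'` and `l = k'` together would contradict `l <
      -- k` and `l' < k'`.
      · rw [legInner_of_ne hk, zero_mul]
    have h2 : legInner k l' * legInner l k' = 0 := by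
      by_cases hk : k = l'
      · rw [legInner_of_ne (k := l) (l := k') (by omega), mul_zero]
      · rw [legInner_of_ne hk, zero_mul]
    rw [inner_triangleMode, h1, h2, sub_zero, Complex.ofReal_zero]
  all_goals
    rintro ⟨⟨k, l⟩, hkl⟩
    have h1 : 1 ≤ Real.pi ^ 2 / 8 := by nlinarith [Real.pi_gt_three]
    have hk0 : (0 : ℝ) ≤ k := k.cast_nonneg
    have hl0 : (0 : ℝ) ≤ l := l.cast_nonneg
    refine le_trans ?_ (le_mul_of_one_le_left (by positivity) h1)
    simp only
    nlinarith

end Triangle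

/-! ### Matching the two families of eigenvalues -/

section IndexBijection

/-- The bijection between the index sets of the triangle and of the square. -/
def indexEquiv : TriangleIndex ≃ SquareIndex where
  -- Of `k - l` and `k + l + 1`, the odd one is `2m + 1` and the even one is `2n`.
  toFun q := ⟨if (q.1.1 - q.1.2) % 2 = 1 then
      ((q.1.1 - q.1.2) / 2, q.1.2 + (q.1.1 - q.1.2) / 2 + 1)
    else (q.1.2 + (q.1.1 - q.1.2) / 2, (q.1.1 - q.1.2) / 2), by
      have := q.2
      split_ifs <;> dsimp only <;> omega⟩
  -- Conversely `2k + 1` is the sum of `2m + 1` and `2n`, and `2l + 1` is the absolute value of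
  -- their difference.
  invFun p := ⟨if p.1.2 ≤ p.1.1 then (p.1.1 + p.1.2, p.1.1 - p.1.2)
    else (p.1.1 + p.1.2, p.1.2 - p.1.1 - 1), by
      have := p.2
      split_ifs <;> dsimp only <;> omega⟩
  left_inv := by
    rintro ⟨⟨k, l⟩, h⟩
    dsimp only at h
    apply Subtype.ext
    dsimp only
    by_cases h1 : (k - l) % 2 = 1
    · simp only [h1, if_true]
      rw [if_neg (by omega)]
      ext <;> dsimp only <;> omega
    · simp only [h1, if_false]
      rw [if_pos (by omega)]
      ext <;> dsimp only <;> omega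
  right_inv := by
    rintro ⟨⟨m, n⟩, h⟩
    dsimp only at h
    apply Subtype.ext
    dsimp only
    by_cases h1 : n ≤ m
    · simp only [h1, if_true]
      rw [if_neg (by omega)]
      ext <;> dsimp only <;> omega
    · simp only [h1, if_false]
      rw [if_pos (by omega)]
      ext <;> dsimp only <;> omega

theorem indexEquiv_of_odd {q : TriangleIndex} {j : ℕ} (h : q.1.1 = q.1.2 + (2 * j + 1)) :
    (indexEquiv q).1 = (j, q.1.2 + j + 1) := by
  change (if _ then _ else _) = _
  rw [if_pos (by omega)]
  ext <;> dsimp only <;> omega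

theorem indexEquiv_of_even {q : TriangleIndex} {j : ℕ} (h : q.1.1 = q.1.2 + 2 * j) :
    (indexEquiv q).1 = (q.1.2 + j, j) := by
  change (if _ then _ else _) = _
  rw [if_neg (by omega)]
  ext <;> dsimp only <;> omega

theorem triangleEV_eq_squareEV (q : TriangleIndex) :
    triangleEV q = squareEV (indexEquiv q) := by
  have hq := q.2
  rcases Nat.even_or_odd' (q.1.1 - q.1.2) with ⟨j, hj | hj⟩
  · have h : q.1.1 = q.1.2 + 2 * j := by omega
    rw [triangleEV, squareEV, indexEquiv_of_even h, h]
    push_cast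
    ring
  · have h : q.1.1 = q.1.2 + (2 * j + 1) := by omega
    rw [triangleEV, squareEV, indexEquiv_of_odd h, h]
    push_cast
    ring

/-- Two discrete spectra enumerated by families which agree up to reindexing coincide. -/
theorem SpectrumIs.isospectral {ι κ : Type} {Ω₁ D₁ Ω₂ D₂ : Set (ℝ × ℝ)} {ev₁ : ι → ℝ}
    {ev₂ : κ → ℝ} (h₁ : SpectrumIs Ω₁ D₁ ev₁) (h₂ : SpectrumIs Ω₂ D₂ ev₂) (e : κ ≃ ι)
    (he : ∀ i, ev₂ i = ev₁ (e i)) : Isospectral Ω₁ D₁ Ω₂ D₂ := by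
  refine ⟨?_, fun z => ?_⟩
  · have : (fun i => (ev₂ i : ℂ)) = (fun i => (ev₁ i : ℂ)) ∘ e := funext fun i => by simp [he]
    rw [h₁.1, h₂.1, this, e.surjective.range_comp]
  · obtain ⟨_, r₁⟩ := h₁.2 z
    obtain ⟨_, r₂⟩ := h₂.2 z
    have hset : {i | (ev₂ i : ℂ) = z} = e ⁻¹' {i | (ev₁ i : ℂ) = z} := by
      ext i
      simp [he]
    rw [hset, Set.encard_preimage_of_bijective e.bijective, ← r₁] at r₂
    rw [← Module.finrank_eq_rank, ← Module.finrank_eq_rank]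
    exact_mod_cast r₂.symm

end IndexBijection

theorem theorem2p1 :
    Isospectral squareΩ squareD triangleΩ triangleD ∧
    SpectrumIs squareΩ squareD squareEV ∧
    SpectrumIs triangleΩ triangleD triangleEV ∧
    ∃ e : TriangleIndex ≃ SquareIndex,
      (∀ q : TriangleIndex, triangleEV q = squareEV (e q)) ∧
      (∀ q : TriangleIndex, ∀ j : ℕ, q.1.1 = q.1.2 + (2 * j + 1) →
        (e q).1 = (j, q.1.2 + j + 1)) ∧
      (∀ q : TriangleIndex, ∀ j : ℕ, q.1.1 = q.1.2 + 2 * j →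
        (e q).1 = (q.1.2 + j, j)) ∧
      (∀ p : SquareIndex, p.1.2 ≤ p.1.1 →
        (e.symm p).1 = (p.1.1 + p.1.2, p.1.1 - p.1.2)) ∧
      (∀ p : SquareIndex, p.1.1 < p.1.2 →
        (e.symm p).1 = (p.1.1 + p.1.2, p.1.2 - p.1.1 - 1)) :=
  ⟨spectrumIs_square.isospectral spectrumIs_triangle indexEquiv triangleEV_eq_squareEV,
    spectrumIs_square, spectrumIs_triangle, indexEquiv, triangleEV_eq_squareEV,
    fun _ _ h => indexEquiv_of_odd h, fun _ _ h => indexEquiv_of_even h,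
    fun _ h => if_pos h, fun _ h => if_neg (not_le.2 h)⟩
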